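/- **Theorem (pseudo recurrent integral manifold).** Let $(\Omega,\mathbb R,\sigma)$ be a dynamical system (a continuous flow, $\omega t=\sigma(t,\omega)$) on a metric space, and let $E$ be a real Banach space. A dynamical system $(X,\mathbb R,\pi)$ is called *pseudo recurrent* if $X$ is compact, some orbit is dense in $X$, and every $x\in X$ is Poisson stable, i.e. $xt_n\to x$ for some real sequence with $|t_n|\to\infty$. For an equation $x'=g(\omega t,x)$, with solutions taking values in a set $D\subseteq E$, a continuous $u:\Omega\to E$ is an *invariant section* if for every $\omega$ the initial value $u(\omega)$ has a unique solution $\psi(t,u(\omega),\omega)$ on $\mathbb R_+$ and $u(\omega t)=\psi(t,u(\omega),\omega)$ for all $t\ge 0$. It is a *pseudo recurrent integral manifold* if, moreover, on its image $\{(u(\omega),\omega):\omega\in\Omega\}\subset E\times\Omega$ the skew-product motion $(x,\omega)\mapsto(\psi(t,x,\omega),\omega t)$, $t\ge0$, extends to a two-sided dynamical system that is pseudo recurrent. Assume that $(\Omega,\mathbb R,\sigma)$ is pseudo recurrent. Then the following hold. 0. Every invariant section of any equation $x'=g(\omega t,x)$ (in any $D\subseteq E$) is a pseudo recurrent integral manifold.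 For 1 and 2 let $A\in C(\Omega,L(E))$, $f\in C(\Omega,E)$, $F\in C(\Omega\times E,E)$, and let $x'=A(\omega t)x$ be hyperbolic: with $U(t,\omega)$ its Cauchy operator, there are $N,\nu>0$ and projections $P\in C(\Omega,L(E))$, $P(\omega)^2=P(\omega)$, such that $U(t,\omega)P(\omega)=P(\omega t)U(t,\omega)$ for all $t$, $\|U(t,\omega)P(\omega)U^{-1}(\tau,\omega)\|\le Ne^{-\nu(t-\tau)}$ for $t\ge\tau$, and $\|U(t,\omega)(I-P(\omega))U^{-1}(\tau,\omega)\|\le Ne^{\nu(t-\tau)}$ for $t\le\tau$. Put $G(t,\tau,\omega)=U(t,\omega)P(\omega)U^{-1}(\tau,\omega)$ for $t>\tau$, $G(t,\tau,\omega)=-U(t,\omega)(I-P(\omega))U^{-1}(\tau,\omega)$ for $t<\tau$, $\gamma(\omega)=\int_{-\infty}^{+\infty}G(0,\tau,\omega)f(\omega\tau)\,d\tau$, $Q=\gamma(\Omega)$, $B[Q,r]=\{x\in E:\rho(x,Q)\le r\}$, and assume that, for some $L,r>0$, $\|F(\omega,x_1)-F(\omega,x_2)\|\le L\|x_1-x_2\|$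 for all $\omega\in\Omega$ and $x_1,x_2\in B[Q,r]$. 1. Suppose that $x'=A(\omega t)x+f(\omega t)+F(\omega t,x)$ has a unique solution on $\mathbb R_+$ for all $\omega\in\Omega$ and all initial values in $E$, that $L<\frac{\nu}{2N}$, and that $r\ge\gamma_0\left(\frac{\nu}{2N}-L\right)^{-1}$, where $\gamma_0=\max_{\omega}\|F(\omega,\gamma(\omega))\|$. Then this equation admits a pseudo recurrent integral manifold $u:\Omega\to B[Q,r]$. 2. Suppose that $\varepsilon_0>0$ and that for every $\varepsilon\in[-\varepsilon_0,\varepsilon_0]$ the equation $x'=A(\omega t)x+f(\omega t)+\varepsilon F(\omega t,x)$ has a unique solution on $\mathbb R_+$ for all $\omega\in\Omega$ and all initial values in $E$. Then there is $\varepsilon_1\in(0,\varepsilon_0]$ such that for every $\varepsilon$ with $|\varepsilon|<\varepsilon_1$ this equation admits a pseudo recurrent integral manifold $u:\Omega\to B[Q,r]$. 3. Let $x_0\in E$, $r,\varepsilon_0>0$, $B=\{x\in E:\|x-x_0\|\le r\}$, and let $f:\Omega\times B\to E$ be continuous and bounded. Suppose that $\overline f(x)=\lim_{T\to+\infty}\frac1T\int_0^Tf(\omega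 t,x)\,dt$ exists uniformly in $(\omega,x)\in\Omega\times B$; that $f$ and $\overline f$ are twice differentiable in $x\in B$, with first and second derivatives continuous on $\Omega\times B$ and on $B$ respectively, and with bounded first derivatives; that $\overline f^{(k)}(x)=\lim_{T\to+\infty}\frac1T\int_0^Tf_x^{(k)}(\omega t,x)\,dt$ uniformly in $(\omega,x)\in\Omega\times B$ for $k=1,2$; that $\overline f(x_0)=0$; and that the spectrum (in the complexification) of $\overline f'(x_0)$ does not meet $i\mathbb R$. Then for all sufficiently small $r_0\in(0,r]$ there is $\varepsilon_1\in(0,\varepsilon_0]$ such that for every $\varepsilon\in(0,\varepsilon_1)$ the equation $x'=\varepsilon f(\omega t,x)$ (in $D=B$) admits a pseudo recurrent integral manifold $u$ with $\|u(\omega)-x_0\|\le r_0$ for all $\omega\in\Omega$. -/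

import Mathlib

open Set Filter Topology MeasureTheory
open scoped TensorProduct

/-- A (two-sided) dynamical system is pseudo recurrent if its phase space is compact, some
orbit is dense, and every point `x` is Poisson stable: `x t_n → x` along some real sequence
with `|t_n| → ∞`. -/
def IsPseudoRecurrent {X : Type*} [TopologicalSpace X] (π : Flow ℝ X) : Prop :=
  CompactSpace X ∧
  (∃ x₀ : X, closure (Set.range fun t : ℝ => π t x₀) = Set.univ) ∧
  ∀ x : X, ∃ t : ℕ → ℝ,
    Tendsto (fun n => π (t n) x) atTop (𝓝 x) ∧ Tendsto (fun n => |t n|) atTop atTop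

section Equations

variable {Ω E : Type*} [TopologicalSpace Ω] [NormedAddCommGroup E] [NormedSpace ℝ E]

/-- `x` is a solution on `[0, ∞)`, with values in `D`, of `x' = g (ω t, x)`, where
`ω t = σ t ω`. The derivative at `t = 0` is one-sided. -/
def IsSolution (σ : Flow ℝ Ω) (g : Ω → E → E) (D : Set E) (ω : Ω) (x : ℝ → E) : Prop :=
  ∀ t : ℝ, 0 ≤ t → x t ∈ D ∧ HasDerivWithinAt x (g (σ t ω) (x t)) (Set.Ici 0) t

/-- `ψ` is the unique solution on `[0, ∞)` of `x' = g (ω t, x)` with values in `D` and with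
`ψ 0 = x`. -/
def IsUniqueSolution (σ : Flow ℝ Ω) (g : Ω → E → E) (D : Set E) (ω : Ω) (x : E)
    (ψ : ℝ → E) : Prop :=
  IsSolution σ g D ω ψ ∧ ψ 0 = x ∧
    ∀ y : ℝ → E, IsSolution σ g D ω y → y 0 = x → Set.EqOn y ψ (Set.Ici 0)

/-- Every initial value problem for `x' = g (ω t, x)` on `E` has a unique solution on
`[0, ∞)`. -/
def HasUniqueSolutions (σ : Flow ℝ Ω) (g : Ω → E → E) : Prop :=
  ∀ (ω : Ω) (x : E), ∃ ψ : ℝ → E, IsUniqueSolution σ g Set.univ ω x ψ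

/-- The continuous map `u` is an invariant section (an integral manifold) of
`x' = g (ω t, x)`: `u (ω t) = ψ (t, u ω, ω)` for all `t ≥ 0`, where `ψ (·, x, ω)` is the unique
solution starting at `x`. -/
def IsInvariantSection (σ : Flow ℝ Ω) (g : Ω → E → E) (D : Set E) (u : C(Ω, E)) : Prop :=
  ∀ ω : Ω, ∃ ψ : ℝ → E, IsUniqueSolution σ g D ω (u ω) ψ ∧
    ∀ t : ℝ, 0 ≤ t → u (σ t ω) = ψ t

/-- The image of the section `ω ↦ (u ω, ω)` in the skew-product phase space `E × Ω`. -/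
def manifoldOf (u : C(Ω, E)) : Set (E × Ω) := Set.range fun ω => (u ω, ω)

/-- `u` is a pseudo recurrent integral manifold of `x' = g (ω t, x)`: it is an invariant
section, and the skew-product motion `(x, ω) ↦ (ψ (t, x, ω), ω t)`, `t ≥ 0`, restricts to the
image of the section, where it extends to a two-sided dynamical system that is pseudo
recurrent. -/
def IsPseudoRecurrentManifold (σ : Flow ℝ Ω) (g : Ω → E → E) (D : Set E) (u : C(Ω, E)) :
    Prop :=
  IsInvariantSection σ g D u ∧
  ∃ π : Flow ℝ (manifoldOf u),
    (∀ (p : manifoldOf u) (ψ : ℝ → E), IsUniqueSolution σ g D p.1.2 p.1.1 ψ →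
      ∀ t : ℝ, 0 ≤ t → (π t p : E × Ω) = (ψ t, σ t p.1.2)) ∧
    IsPseudoRecurrent π

/-- `U (t, ω)` is the Cauchy operator of `x' = A (ω t) x`:
`U (0, ω) = I` and `∂U/∂t = A (ω t) U`. -/
def IsCauchyOperator (σ : Flow ℝ Ω) (A : C(Ω, E →L[ℝ] E)) (U : ℝ → Ω → (E →L[ℝ] E)) : Prop :=
  ∀ ω : Ω, U 0 ω = 1 ∧ ∀ t : ℝ, HasDerivAt (fun s => U s ω) (A (σ t ω) * U t ω) t

/-- Hyperbolicity of the linear equation with Cauchy operator `U`, with constants `N`, `ν` and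
the continuous family of projections `P`. The operators `U t ω` are invertible, so
`Ring.inverse` is the true inverse. -/
structure IsHyperbolic (σ : Flow ℝ Ω) (U : ℝ → Ω → (E →L[ℝ] E)) (P : C(Ω, E →L[ℝ] E))
    (N ν : ℝ) : Prop where
  N_pos : 0 < N
  nu_pos : 0 < ν
  proj : ∀ ω, P ω * P ω = P ω
  comm : ∀ t ω, U t ω * P ω = P (σ t ω) * U t ω
  stable : ∀ ω t τ, τ ≤ t →
    ‖U t ω * P ω * Ring.inverse (U τ ω)‖ ≤ N * Real.exp (-ν * (t - τ))
  unstable : ∀ ω t τ, t ≤ τ →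
    ‖U t ω * (1 - P ω) * Ring.inverse (U τ ω)‖ ≤ N * Real.exp (ν * (t - τ))

/-- Green's function `G (t, τ, ω)`; the value at `t = τ` is irrelevant. -/
noncomputable def green (U : ℝ → Ω → (E →L[ℝ] E)) (P : C(Ω, E →L[ℝ] E)) (t τ : ℝ) (ω : Ω) :
    E →L[ℝ] E :=
  if τ < t then U t ω * P ω * Ring.inverse (U τ ω)
  else -(U t ω * (1 - P ω) * Ring.inverse (U τ ω))

/-- `γ (ω) = ∫ G (0, τ, ω) f (ω τ) dτ` over the real line. -/
noncomputable def greenSection (σ : Flow ℝ Ω) (U : ℝ → Ω → (E →L[ℝ] E)) (P : C(Ω, E →L[ℝ] E))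
    (f : C(Ω, E)) (ω : Ω) : E :=
  ∫ τ : ℝ, green U P 0 τ ω (f (σ τ ω))

/-- The spectrum of a bounded operator of a real Banach space: the complex spectrum of its
complexification `1 ⊗ A` in the complexified operator algebra `ℂ ⊗ L(E)`. -/
noncomputable def complexSpectrum (A : E →L[ℝ] E) : Set ℂ :=
  spectrum ℂ ((1 : ℂ) ⊗ₜ[ℝ] A : ℂ ⊗[ℝ] (E →L[ℝ] E))

/-- The time averages `(1/T) ∫₀ᵀ φ (ω t, x) dt` converge to `φbar x` as `T → ∞`, uniformly in
`ω ∈ Ω` and `x ∈ B`. -/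
def AveragesTo {V : Type*} [NormedAddCommGroup V] [NormedSpace ℝ V] (σ : Flow ℝ Ω)
    (φ : Ω → E → V) (φbar : E → V) (B : Set E) : Prop :=
  TendstoUniformlyOn (fun (T : ℝ) (p : Ω × E) => T⁻¹ • ∫ t in (0 : ℝ)..T, φ (σ t p.1) p.2)
    (fun p => φbar p.2) atTop (Set.univ ×ˢ B)

/-- The averaging conditions on the ball `B[x₀, r]`: `f` is continuous and bounded and has the
average `fbar`; `f` and `fbar` are twice continuously differentiable in `x`, with derivatives
`f₁, f₂` and `fbar₁, fbar₂`, of which the first ones are bounded; and the averaging relation may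
be differentiated twice. -/
structure AveragingConditions (σ : Flow ℝ Ω) (x₀ : E) (r : ℝ)
    (f : Ω → E → E) (f₁ : Ω → E → (E →L[ℝ] E)) (f₂ : Ω → E → (E →L[ℝ] E →L[ℝ] E))
    (fbar : E → E) (fbar₁ : E → (E →L[ℝ] E)) (fbar₂ : E → (E →L[ℝ] E →L[ℝ] E)) : Prop where
  cont : ContinuousOn (Function.uncurry f) (Set.univ ×ˢ Metric.closedBall x₀ r)
  bdd : ∃ M : ℝ, ∀ ω, ∀ x ∈ Metric.closedBall x₀ r, ‖f ω x‖ ≤ M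
  deriv₁ : ∀ ω, ∀ x ∈ Metric.closedBall x₀ r,
    HasFDerivWithinAt (f ω) (f₁ ω x) (Metric.closedBall x₀ r) x
  deriv₂ : ∀ ω, ∀ x ∈ Metric.closedBall x₀ r,
    HasFDerivWithinAt (f₁ ω) (f₂ ω x) (Metric.closedBall x₀ r) x
  cont₁ : ContinuousOn (Function.uncurry f₁) (Set.univ ×ˢ Metric.closedBall x₀ r)
  cont₂ : ContinuousOn (Function.uncurry f₂) (Set.univ ×ˢ Metric.closedBall x₀ r)
  bdd₁ : ∃ M : ℝ, ∀ ω, ∀ x ∈ Metric.closedBall x₀ r, ‖f₁ ω x‖ ≤ M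
  bar_deriv₁ : ∀ x ∈ Metric.closedBall x₀ r,
    HasFDerivWithinAt fbar (fbar₁ x) (Metric.closedBall x₀ r) x
  bar_deriv₂ : ∀ x ∈ Metric.closedBall x₀ r,
    HasFDerivWithinAt fbar₁ (fbar₂ x) (Metric.closedBall x₀ r) x
  bar_cont₂ : ContinuousOn fbar₂ (Metric.closedBall x₀ r)
  bar_bdd₁ : ∃ M : ℝ, ∀ x ∈ Metric.closedBall x₀ r, ‖fbar₁ x‖ ≤ M
  average : AveragesTo σ f fbar (Metric.closedBall x₀ r)
  average₁ : AveragesTo σ f₁ fbar₁ (Metric.closedBall x₀ r)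
  average₂ : AveragesTo σ f₂ fbar₂ (Metric.closedBall x₀ r)

end Equations

/-! The section `ω ↦ (u ω, ω)` is a homeomorphism onto its image and conjugates `σ` to the
skew-product motion. Pseudo recurrence is invariant under conjugacy, so every invariant section
inherits it (`IsInvariantSection.isPseudoRecurrentManifold`). What remains is to construct
continuous invariant sections.

For a hyperbolic linear part, `greenSection` gives the bounded solution of the inhomogeneous
equation with forcing read along the flow. It is continuous in `ω` by dominated convergence, and its
norm is at most `2N/ν` times that of the forcing. An invariant section of the quasilinear equation
is a fixed point of `v ↦ G(f + F(·, v))`, with `G` this solution operator on `C(Ω, E)`. The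
smallness of `L` makes the map a contraction, and the lower bound on `r` makes a ball around `γ`
invariant (`IsHyperbolic.exists_isInvariantSection`). The perturbed equation is the same statement
for `ε F`.

For averaging, put `A = fbar' x₀`. The spectral condition yields an exponential dichotomy of `exp (t
A)`: over the complexification, the stable part of the group is a contour integral over a circle
obtained from the imaginary axis by a Cayley transform (`exists_exponential_splitting`), and the
dichotomy is its real part (`exists_exponential_dichotomy`). In `w' = ε (A w + h)` the rate `εν` and
the forcing `ε h` compensate, so the solution operator `S` has norm bounded independently of `ε`.
Moreover `S h` moves at speed `O(ε)` and `S` commutes with time averages, so `S h` is small whenever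
`h` has small average, even if `h` is not small (`IsGreenOperator.norm_le_of_timeAverage`). Writing
`u = x₀ + S k` turns the nonlinear equation into a fixed point problem for `k`, whose map is not
contractive but whose second iterate is (`IsGreenOperator.exists_fixedPoint`). -/

/-! ### Transport of pseudo recurrence; a fixed point theorem. -/

/-- A continuous section is a homeomorphism onto its image. -/
def sectionHomeomorph {Ω E : Type*} [TopologicalSpace Ω] [NormedAddCommGroup E] (u : C(Ω, E)) :
    Ω ≃ₜ manifoldOf u where
  toFun ω := ⟨(u ω, ω), ω, rfl⟩
  invFun p := p.1.2
  left_inv _ := rfl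
  right_inv := by
    rintro ⟨_, ω, rfl⟩
    rfl
  continuous_toFun := by fun_prop
  continuous_invFun := by fun_prop

/-- A flow transported along a homeomorphism. -/
def Flow.transport {X Y : Type*} [TopologicalSpace X] [TopologicalSpace Y] (σ : Flow ℝ X)
    (e : X ≃ₜ Y) : Flow ℝ Y where
  toFun t y := e (σ t (e.symm y))
  cont' := by
    have := σ.cont'
    change Continuous fun p : ℝ × Y => e (σ p.1 (e.symm p.2))
    fun_prop
  map_add' t₁ t₂ y := by simp [σ.map_add]
  map_zero' y := by simp

theorem IsPseudoRecurrent.transport {X Y : Type*} [TopologicalSpace X] [TopologicalSpace Y]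
    {σ : Flow ℝ X} (h : IsPseudoRecurrent σ) (e : X ≃ₜ Y) :
    IsPseudoRecurrent (σ.transport e) := by
  obtain ⟨hc, ⟨x₀, hx₀⟩, hp⟩ := h
  refine ⟨e.compactSpace, ⟨e x₀, ?_⟩, fun y => ?_⟩
  · have : (Set.range fun t : ℝ => σ.transport e t (e x₀)) = e '' Set.range fun t => σ t x₀ := by
      rw [← Set.range_comp]
      refine congrArg _ (funext fun t => ?_)
      simp [Flow.transport]
    rw [this, ← e.image_closure, hx₀, Set.image_univ, e.range_coe]
  · obtain ⟨t, ht, ht'⟩ := hp (e.symm y)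
    refine ⟨t, ?_, ht'⟩
    have := (e.continuous.tendsto _).comp ht
    simpa [Flow.transport, Function.comp_def] using this

/-- Backward motion on the image comes from `σ` itself, so the differential equation need not be
solvable for negative time. Uniqueness of solutions identifies the transported flow with the skew
product for `t ≥ 0`. -/
theorem IsInvariantSection.isPseudoRecurrentManifold {Ω E : Type*} [TopologicalSpace Ω]
    [NormedAddCommGroup E] [NormedSpace ℝ E] {σ : Flow ℝ Ω} (hσ : IsPseudoRecurrent σ)
    {g : Ω → E → E} {D : Set E} {u : C(Ω, E)} (hu : IsInvariantSection σ g D u) :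
    IsPseudoRecurrentManifold σ g D u := by
  refine ⟨hu, σ.transport (sectionHomeomorph u), ?_, hσ.transport _⟩
  rintro ⟨_, ω, rfl⟩ ψ hψ t ht
  obtain ⟨ψ', hψ', h⟩ := hu ω
  have h1 : ψ' t = ψ t := hψ.2.2 ψ' hψ'.1 hψ'.2.1 ht
  change (u (σ t ω), σ t ω) = (ψ t, σ t ω)
  rw [h t ht, h1]

/-- The Banach fixed point theorem for a self-map of a closed set, some iterate of which is a
contraction. -/
theorem exists_fixedPoint_of_iterate {X : Type*} [MetricSpace X] [CompleteSpace X] {s : Set X}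
    (hs : IsClosed s) (hne : s.Nonempty) {f : X → X} (hf : MapsTo f s s) (n : ℕ) {K : ℝ}
    (hK₀ : 0 ≤ K) (hK : K < 1)
    (h : ∀ x ∈ s, ∀ y ∈ s, dist (f^[n] x) (f^[n] y) ≤ K * dist x y) : ∃ x ∈ s, f x = x := by
  have : CompleteSpace s := hs.completeSpace_coe
  have : Nonempty s := hne.to_subtype
  let g : s → s := hf.restrict f s s
  have hg : ∀ x : s, ((g^[n] x : s) : X) = f^[n] x := fun x => by
    rw [hf.iterate_restrict]
    rfl
  have hc : ContractingWith ⟨K, hK₀⟩ g^[n] := by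
    refine ⟨by exact_mod_cast hK, LipschitzWith.of_dist_le_mul fun x y => ?_⟩
    rw [Subtype.dist_eq, hg, hg]
    exact h x x.2 y y.2
  have hfix := hc.isFixedPt_fixedPoint_iterate
  exact ⟨_, (ContractingWith.fixedPoint _ hc).2, congrArg Subtype.val hfix⟩

/-! ### The Cauchy operator: cocycle property and continuity in the base point. -/

section Cauchy

variable {Ω E : Type*} [TopologicalSpace Ω] [NormedAddCommGroup E] [NormedSpace ℝ E]
  {σ : Flow ℝ Ω} {A : C(Ω, E →L[ℝ] E)} {U : ℝ → Ω → (E →L[ℝ] E)}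

theorem lipschitzWith_mul_left_of_norm_le {R : Type*} [NormedRing R] {a : R} {C : NNReal}
    (ha : ‖a‖ ≤ C) : LipschitzWith C (fun x : R => a * x) := by
  refine LipschitzWith.of_dist_le_mul fun x y => ?_
  rw [dist_eq_norm, dist_eq_norm, ← mul_sub]
  exact (norm_mul_le _ _).trans (mul_le_mul_of_nonneg_right ha (norm_nonneg _))

theorem lipschitzWith_apply_of_norm_le {a : E →L[ℝ] E} {C : NNReal}
    (ha : ‖a‖ ≤ C) : LipschitzWith C (fun x : E => a x) := by
  refine LipschitzWith.of_dist_le_mul fun x y => ?_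
  rw [dist_eq_norm, dist_eq_norm, ← map_sub]
  exact a.le_of_opNorm_le ha _

/-- Continuous dependence on the coefficient: `d = x - y` satisfies `d' = a d + (a - b) y`, to which
Gronwall's inequality applies. -/
theorem norm_sub_le_gronwallBound_of_linear {R : Type*} [NormedRing R] [NormedAlgebra ℝ R]
    {a b x y : ℝ → R} {K δ C T : ℝ} (hT : 0 ≤ T) (hδ : 0 ≤ δ)
    (hx : ∀ t, HasDerivAt x (a t * x t) t) (hy : ∀ t, HasDerivAt y (b t * y t) t)
    (h0 : x 0 = y 0) (ha : ∀ t, ‖a t‖ ≤ K) (hab : ∀ t ∈ Icc 0 T, ‖a t - b t‖ ≤ δ)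
    (hC : ∀ t ∈ Icc 0 T, ‖y t‖ ≤ C) : ‖x T - y T‖ ≤ gronwallBound 0 K (δ * C) T := by
  have hd : ∀ t, HasDerivAt (fun t => x t - y t) (a t * x t - b t * y t) t :=
    fun t => (hx t).sub (hy t)
  have := norm_le_gronwallBound_of_norm_deriv_right_le (a := 0) (b := T) (δ := 0) (K := K)
    (ε := δ * C) (fun t _ => (hd t).continuousAt.continuousWithinAt)
    (fun t _ => (hd t).hasDerivWithinAt) (by simp [h0]) (fun t ht => ?_) T ⟨hT, le_rfl⟩
  · simpa using this
  · have ht' : t ∈ Icc 0 T := ⟨ht.1, ht.2.le⟩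
    have h1 : a t * x t - b t * y t = a t * (x t - y t) + (a t - b t) * y t := by noncomm_ring
    rw [h1]
    refine (norm_add_le _ _).trans (add_le_add ?_ ?_)
    · exact (norm_mul_le _ _).trans (mul_le_mul_of_nonneg_right (ha t) (norm_nonneg _))
    · exact (norm_mul_le _ _).trans (mul_le_mul (hab t ht') (hC t ht') (norm_nonneg _) hδ)

theorem IsCauchyOperator.continuous_time (hU : IsCauchyOperator σ A U) (ω : Ω) :
    Continuous fun t => U t ω :=
  continuous_iff_continuousAt.2 fun t => ((hU ω).2 t).continuousAt

variable [CompactSpace Ω]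

/-- Cocycle identity. -/
theorem IsCauchyOperator.cocycle (hU : IsCauchyOperator σ A U) (t s : ℝ) (ω : Ω) :
    U (t + s) ω = U t (σ s ω) * U s ω := by
  have key : (fun t => U (t + s) ω) = fun t => U t (σ s ω) * U s ω := by
    refine ODE_solution_unique_univ (v := fun t X => A (σ t (σ s ω)) * X) (s := fun _ => univ)
      (K := ‖A‖₊) (t₀ := 0)
      (fun t => (lipschitzWith_mul_left_of_norm_le (A.norm_coe_le_norm _)).lipschitzOnWith)
      (fun t => ⟨?_, trivial⟩) (fun t => ⟨?_, trivial⟩) (by simp [(hU (σ s ω)).1])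
    · have := ((hU ω).2 (t + s)).scomp t ((hasDerivAt_id t).add_const s)
      simpa [σ.map_add, Function.comp_def] using this
    · have := ((hU (σ s ω)).2 t).mul_const (U s ω)
      simpa [mul_assoc] using this
  exact congrFun key t

theorem IsCauchyOperator.neg_mul (hU : IsCauchyOperator σ A U) (t : ℝ) (ω : Ω) :
    U (-t) (σ t ω) * U t ω = 1 := by
  rw [← hU.cocycle, neg_add_cancel, (hU ω).1]

theorem IsCauchyOperator.mul_neg (hU : IsCauchyOperator σ A U) (t : ℝ) (ω : Ω) :
    U t ω * U (-t) (σ t ω) = 1 := by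
  have := hU.neg_mul (-t) (σ t ω)
  rwa [neg_neg, ← σ.map_add, neg_add_cancel, σ.map_zero_apply] at this

/-- `U t ω` as a unit. -/
def IsCauchyOperator.unit (hU : IsCauchyOperator σ A U) (t : ℝ) (ω : Ω) : (E →L[ℝ] E)ˣ :=
  ⟨U t ω, U (-t) (σ t ω), hU.mul_neg t ω, hU.neg_mul t ω⟩

theorem IsCauchyOperator.inverse_eq (hU : IsCauchyOperator σ A U) (t : ℝ) (ω : Ω) :
    Ring.inverse (U t ω) = U (-t) (σ t ω) :=
  Ring.inverse_unit (hU.unit t ω)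

theorem IsCauchyOperator.continuous_time_inverse [CompleteSpace E] (hU : IsCauchyOperator σ A U)
    (ω : Ω) : Continuous fun t => U (-t) (σ t ω) := by
  refine continuous_iff_continuousAt.2 fun t => ?_
  have h : ContinuousAt (fun s => Ring.inverse (U s ω)) t :=
    ContinuousAt.comp (g := Ring.inverse) (NormedRing.inverse_continuousAt (hU.unit t ω))
      (hU.continuous_time ω).continuousAt
  simpa only [hU.inverse_eq] using h

/-- By the tube lemma the coefficients along nearby orbits are uniformly close on `[0, T]`, and the
Gronwall bound tends to `0` with their distance `δ`. Negative times are reached afterwards by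
inversion. -/
theorem IsCauchyOperator.continuous_of_nonneg (hU : IsCauchyOperator σ A U) {T : ℝ} (hT : 0 ≤ T) :
    Continuous fun ω => U T ω := by
  refine continuous_iff_continuousAt.2 fun ω₀ => ?_
  obtain ⟨C, hC⟩ := isCompact_Icc.exists_bound_of_continuousOn
    (hU.continuous_time ω₀).continuousOn (s := Icc 0 T)
  have hC0 : 0 ≤ C := (norm_nonneg _).trans (hC 0 ⟨le_rfl, hT⟩)
  have hlim : Tendsto (fun δ : ℝ => gronwallBound 0 ‖A‖ (δ * C) T) (𝓝 0) (𝓝 0) := by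
    have hc : Continuous fun δ : ℝ => gronwallBound 0 ‖A‖ (δ * C) T :=
      (gronwallBound_continuous_ε 0 ‖A‖ T).comp (by fun_prop)
    simpa [gronwallBound_ε0_δ0] using hc.tendsto 0
  rw [ContinuousAt, Metric.tendsto_nhds]
  intro ε hε
  obtain ⟨δ, hδ, hδε⟩ : ∃ δ > 0, gronwallBound 0 ‖A‖ (δ * C) T < ε := by
    have h1 := hlim.eventually (gt_mem_nhds hε)
    have h2 := (h1.filter_mono nhdsWithin_le_nhds).and (self_mem_nhdsWithin (s := Ioi (0 : ℝ)))
    obtain ⟨δ, h3, h4⟩ := h2.exists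
    exact ⟨δ, h4, h3⟩
  have hev : ∀ᶠ ω in 𝓝 ω₀, ∀ t ∈ Icc (0 : ℝ) T, dist (A (σ t ω₀)) (A (σ t ω)) < δ := by
    have hopen : IsOpen {p : Ω × ℝ | dist (A (σ p.2 ω₀)) (A (σ p.2 p.1)) < δ} := by
      have hA := A.continuous
      exact isOpen_lt (by fun_prop) continuous_const
    have := generalized_tube_lemma (s := {ω₀}) (t := Icc (0 : ℝ) T) isCompact_singleton
      isCompact_Icc hopen
      (by rintro ⟨ω, t⟩ ⟨rfl, -⟩; simpa using hδ)
    obtain ⟨u, v, hu, -, hu0, hv, huv⟩ := this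
    filter_upwards [hu.mem_nhds (hu0 rfl)] with ω hω t ht
    have h : (ω, t) ∈ u ×ˢ v := ⟨hω, hv ht⟩
    have h' := huv h
    rw [mem_ofPred_eq] at h'
    exact h'
  filter_upwards [hev] with ω hω
  have := norm_sub_le_gronwallBound_of_linear (R := E →L[ℝ] E) (a := fun t => A (σ t ω))
    (b := fun t => A (σ t ω₀)) (x := fun t => U t ω) (y := fun t => U t ω₀) (K := ‖A‖)
    hT hδ.le (hU ω).2 (hU ω₀).2
    ((hU ω).1.trans (hU ω₀).1.symm) (fun t => A.norm_coe_le_norm (σ t ω))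
    (fun t ht => by simpa only [dist_eq_norm, norm_sub_rev] using (hω t ht).le) hC
  rw [dist_eq_norm]
  exact this.trans_lt hδε

theorem IsCauchyOperator.continuous [CompleteSpace E] (hU : IsCauchyOperator σ A U) (T : ℝ) :
    Continuous fun ω => U T ω := by
  rcases le_total 0 T with hT | hT
  · exact hU.continuous_of_nonneg hT
  · have h1 : (fun ω => U T ω) = fun ω => Ring.inverse (U (-T) (σ T ω)) := by
      funext ω
      rw [hU.inverse_eq, ← σ.map_add]
      simp
    rw [h1]
    refine continuous_iff_continuousAt.2 fun ω => ?_
    exact ContinuousAt.comp (g := Ring.inverse)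
      (NormedRing.inverse_continuousAt (hU.unit (-T) (σ T ω)))
      ((hU.continuous_of_nonneg (neg_nonneg.2 hT)).comp (σ.continuous_toFun T)).continuousAt

theorem IsCauchyOperator.eq_apply_of_hasDerivAt (hU : IsCauchyOperator σ A U) {ω : Ω} {z : ℝ → E}
    (hz : ∀ t, HasDerivAt z (A (σ t ω) (z t)) t) (t : ℝ) : z t = U t ω (z 0) := by
  have key : z = fun t => U t ω (z 0) := by
    refine ODE_solution_unique_univ (v := fun t x => A (σ t ω) x) (s := fun _ => univ)
      (K := ‖A‖₊) (t₀ := 0)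
      (fun t => (lipschitzWith_apply_of_norm_le (A.norm_coe_le_norm _)).lipschitzOnWith)
      (fun t => ⟨hz t, trivial⟩) (fun t => ⟨?_, trivial⟩) (by simp [(hU ω).1])
    have := ((hU ω).2 t).clm_apply (hasDerivAt_const t (z 0))
    simpa using this
  exact congrFun key t

end Cauchy

/-! ### Green's function and the bounded solution of a hyperbolic equation. -/

theorem integrable_exp_neg_mul_abs {ν : ℝ} (hν : 0 < ν) :
    Integrable fun τ : ℝ => Real.exp (-ν * |τ|) := by
  have h := (exp_neg_integrableOn_Ioi 0 hν)
  rw [← integrableOn_univ, ← Set.Iic_union_Ioi (a := (0 : ℝ)), integrableOn_union]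
  refine ⟨?_, h.congr_fun (fun x hx => by simp [abs_of_pos (show (0 : ℝ) < x from hx)])
    measurableSet_Ioi⟩
  have h2 : IntegrableOn (fun τ : ℝ => Real.exp (ν * τ)) (Iic 0) := by
    simpa [integrableOn_Iic_iff_integrableOn_Iio] using integrableOn_exp_mul_Iic hν 0
  exact h2.congr_fun (fun x hx => by simp [abs_of_nonpos (show x ≤ (0 : ℝ) from hx)])
    measurableSet_Iic

theorem integral_exp_neg_mul_abs {ν : ℝ} (hν : 0 < ν) :
    ∫ τ : ℝ, Real.exp (-ν * |τ|) = 2 / ν := by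
  rw [integral_comp_abs (f := fun x => Real.exp (-ν * x)),
    integral_exp_mul_Ioi (neg_lt_zero.2 hν)]
  simp
  ring

section Green

variable {Ω E : Type*} [TopologicalSpace Ω]
  [NormedAddCommGroup E] [NormedSpace ℝ E] {σ : Flow ℝ Ω} {A : C(Ω, E →L[ℝ] E)}
  {U : ℝ → Ω → (E →L[ℝ] E)} {P : C(Ω, E →L[ℝ] E)} {N ν : ℝ}

theorem IsHyperbolic.norm_green_zero_le (hU : ∀ ω, U 0 ω = 1)
    (hH : IsHyperbolic σ U P N ν) (τ : ℝ) (ω : Ω) :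
    ‖green U P 0 τ ω‖ ≤ N * Real.exp (-ν * |τ|) := by
  rcases lt_or_ge τ 0 with h | h
  · rw [green, if_pos h, abs_of_neg h]
    simpa [hU ω] using hH.stable ω 0 τ h.le
  · rw [green, if_neg h.not_gt, abs_of_nonneg h, norm_neg]
    simpa [hU ω] using hH.unstable ω 0 τ h

variable [CompactSpace Ω]

theorem IsCauchyOperator.green_zero (hU : IsCauchyOperator σ A U) (τ : ℝ) (ω : Ω) :
    green U P 0 τ ω = if τ < 0 then P ω * U (-τ) (σ τ ω)
      else -((1 - P ω) * U (-τ) (σ τ ω)) := by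
  simp only [green, hU.inverse_eq, (hU ω).1, one_mul]

theorem IsHyperbolic.norm_green_apply_le (hU : IsCauchyOperator σ A U)
    (hH : IsHyperbolic σ U P N ν) (h : C(Ω, E)) (τ : ℝ) (ω : Ω) :
    ‖green U P 0 τ ω (h (σ τ ω))‖ ≤ N * ‖h‖ * Real.exp (-ν * |τ|) := by
  refine ((green U P 0 τ ω).le_of_opNorm_le_of_le (hH.norm_green_zero_le (fun ω => (hU ω).1) τ ω)
    (h.norm_coe_le_norm _)).trans_eq ?_
  ring

/-- The only bounded solution of a hyperbolic homogeneous equation is zero. -/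
theorem IsHyperbolic.eq_zero_of_bounded (hU : IsCauchyOperator σ A U)
    (hH : IsHyperbolic σ U P N ν) {ω : Ω} {z : ℝ → E} {C : ℝ}
    (hz : ∀ t, HasDerivAt z (A (σ t ω) (z t)) t) (hC : ∀ t, ‖z t‖ ≤ C) : z 0 = 0 := by
  have hback : ∀ t, z 0 = U (-t) (σ t ω) (z t) := fun t => by
    rw [hU.eq_apply_of_hasDerivAt hz t, ← mul_apply_eq_comp, hU.neg_mul]
    rfl
  have hlim : Tendsto (fun s => N * Real.exp (-ν * s) * C) atTop (𝓝 0) := by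
    have : Tendsto (fun s => Real.exp (-ν * s)) atTop (𝓝 0) :=
      Real.tendsto_exp_atBot.comp (tendsto_id.const_mul_atTop_of_neg (neg_lt_zero.2 hH.nu_pos))
    simpa using (this.const_mul N).mul_const C
  -- The stable component of `z 0` is carried forward from the remote past, the complementary one
  -- backward from the remote future. Exponential decay against the bound `C` kills both.
  have h1 : P ω (z 0) = 0 := by
    refine norm_le_zero_iff.1 (ge_of_tendsto hlim ?_)
    filter_upwards [eventually_gt_atTop 0] with s hs
    have h2 : P ω (z 0) = green U P 0 (-s) ω (z (-s)) := by
      rw [hU.green_zero, if_pos (neg_lt_zero.2 hs), hback (-s)]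
      rfl
    have h3 := hH.norm_green_zero_le (fun ω => (hU ω).1) (-s) ω
    rw [abs_neg, abs_of_pos hs] at h3
    rw [h2]
    exact (green U P 0 (-s) ω).le_of_opNorm_le_of_le h3 (hC _)
  have h4 : z 0 - P ω (z 0) = 0 := by
    refine norm_le_zero_iff.1 (ge_of_tendsto hlim ?_)
    filter_upwards [eventually_gt_atTop 0] with s hs
    have h2 : z 0 - P ω (z 0) = -(green U P 0 s ω (z s)) := by
      rw [hU.green_zero, if_neg hs.not_gt, hback s]
      simp
    have h3 := hH.norm_green_zero_le (fun ω => (hU ω).1) s ω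
    rw [abs_of_pos hs] at h3
    rw [h2, norm_neg]
    exact (green U P 0 s ω).le_of_opNorm_le_of_le h3 (hC _)
  rwa [h1, sub_zero] at h4

theorem IsHyperbolic.norm_greenSection_le (hU : IsCauchyOperator σ A U)
    (hH : IsHyperbolic σ U P N ν) (h : C(Ω, E)) (ω : Ω) :
    ‖greenSection σ U P h ω‖ ≤ 2 * N / ν * ‖h‖ := by
  refine (norm_integral_le_of_norm_le
    ((integrable_exp_neg_mul_abs hH.nu_pos).const_mul (N * ‖h‖))
    (Eventually.of_forall fun τ => hH.norm_green_apply_le hU h τ ω)).trans_eq ?_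
  rw [integral_const_mul, integral_exp_neg_mul_abs hH.nu_pos]
  ring

variable [CompleteSpace E]

theorem IsCauchyOperator.stronglyMeasurable_green_apply (hU : IsCauchyOperator σ A U)
    (h : C(Ω, E)) (ω : Ω) :
    AEStronglyMeasurable (fun τ => green U P 0 τ ω (h (σ τ ω))) := by
  have hc := hU.continuous_time_inverse ω
  have hσ : Continuous fun τ => σ τ ω := by fun_prop
  have hh : Continuous fun τ => h (σ τ ω) := h.continuous.comp hσ
  simp only [hU.green_zero]
  have h1 : Continuous fun τ => (P ω * U (-τ) (σ τ ω)) (h (σ τ ω)) :=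
    (continuous_const.mul hc).clm_apply hh
  have h2 : Continuous fun τ => (-((1 - P ω) * U (-τ) (σ τ ω))) (h (σ τ ω)) :=
    (continuous_const.mul hc).neg.clm_apply hh
  have h3 : (fun τ => (if τ < 0 then P ω * U (-τ) (σ τ ω)
      else -((1 - P ω) * U (-τ) (σ τ ω))) (h (σ τ ω))) =
      (Iio (0 : ℝ)).piecewise (fun τ => (P ω * U (-τ) (σ τ ω)) (h (σ τ ω)))
        (fun τ => (-((1 - P ω) * U (-τ) (σ τ ω))) (h (σ τ ω))) := by
    classical
    funext τ
    by_cases hτ : τ < 0 <;> simp [Set.piecewise, hτ]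
  rw [h3]
  exact AEStronglyMeasurable.piecewise measurableSet_Iio
    h1.aestronglyMeasurable h2.aestronglyMeasurable

theorem IsHyperbolic.integrable_green (hU : IsCauchyOperator σ A U)
    (hH : IsHyperbolic σ U P N ν) (h : C(Ω, E)) (ω : Ω) :
    Integrable (fun τ => green U P 0 τ ω (h (σ τ ω))) :=
  ((integrable_exp_neg_mul_abs hH.nu_pos).const_mul (N * ‖h‖)).mono'
    (hU.stronglyMeasurable_green_apply h ω)
    (Eventually.of_forall fun τ => hH.norm_green_apply_le hU h τ ω)

theorem IsHyperbolic.greenSection_sub (hU : IsCauchyOperator σ A U)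
    (hH : IsHyperbolic σ U P N ν) (h₁ h₂ : C(Ω, E)) (ω : Ω) :
    greenSection σ U P h₁ ω - greenSection σ U P h₂ ω = greenSection σ U P (h₁ - h₂) ω := by
  simp only [greenSection, ContinuousMap.sub_apply, map_sub]
  exact (integral_sub (hH.integrable_green hU h₁ ω) (hH.integrable_green hU h₂ ω)).symm

theorem IsHyperbolic.continuous_greenSection [FirstCountableTopology Ω]
    (hU : IsCauchyOperator σ A U) (hH : IsHyperbolic σ U P N ν) (h : C(Ω, E)) :
    Continuous (greenSection σ U P h) := by
  refine continuous_of_dominated (fun ω => hU.stronglyMeasurable_green_apply h ω)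
    (fun ω => Eventually.of_forall fun τ => hH.norm_green_apply_le hU h τ ω)
    ((integrable_exp_neg_mul_abs hH.nu_pos).const_mul (N * ‖h‖))
    (Eventually.of_forall fun τ => ?_)
  have hσ : Continuous fun ω => σ τ ω := by fun_prop
  have hc : Continuous fun ω => U (-τ) (σ τ ω) := (hU.continuous (-τ)).comp hσ
  refine Continuous.clm_apply ?_ (h.continuous.comp hσ)
  rw [funext fun ω => hU.green_zero (P := P) τ ω]
  split_ifs
  · exact P.continuous.mul hc
  · exact ((continuous_const.sub P.continuous).mul hc).neg

/-- Variation of constants for the Green section. -/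
theorem IsHyperbolic.greenSection_flow (hU : IsCauchyOperator σ A U)
    (hH : IsHyperbolic σ U P N ν) (h : C(Ω, E)) (t : ℝ) (ω : Ω) :
    greenSection σ U P h (σ t ω) =
      U t ω (greenSection σ U P h ω + ∫ s in (0 : ℝ)..t, U (-s) (σ s ω) (h (σ s ω))) := by
  have hσ : Continuous fun τ => σ τ ω := by fun_prop
  set k : ℝ → E := fun s => U (-s) (σ s ω) (h (σ s ω)) with hk
  have hkc : Continuous k := (hU.continuous_time_inverse ω).clm_apply (h.continuous.comp hσ)
  have hki : ∀ a b, IntegrableOn k (Ico a b) := fun a b =>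
    (hkc.continuousOn.integrableOn_compact isCompact_Icc).mono_set Ico_subset_Icc_self
  -- Moving the base point to `σ t ω` multiplies the kernel by `U t ω` and moves its jump from `0`
  -- to `t`. Between the two points the branches differ by `P + (1 - P) = 1`, which leaves the full
  -- term `k`. The two indicators carry the sign of the oriented integral, one for each sign of `t`.
  have hshift : ∀ s, green U P 0 (s - t) (σ t ω) (h (σ (s - t) (σ t ω))) =
      U t ω (green U P 0 s ω (h (σ s ω)) +
        ((Ico 0 t).indicator k s - (Ico t 0).indicator k s)) := by
    intro s
    have e1 : σ (s - t) (σ t ω) = σ s ω := by rw [← σ.map_add, sub_add_cancel]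
    have e2 : U (-(s - t)) (σ s ω) = U t ω * U (-s) (σ s ω) := by
      have := hU.cocycle t (-s) (σ s ω)
      rw [← σ.map_add, neg_add_cancel, σ.map_zero_apply] at this
      rw [← this]
      congr 1
      ring
    have e3 : P (σ t ω) * (U t ω * U (-s) (σ s ω)) = U t ω * (P ω * U (-s) (σ s ω)) := by
      rw [← mul_assoc, ← hH.comm, mul_assoc]
    rw [hU.green_zero, hU.green_zero, e1, e2, sub_mul, sub_mul, e3, one_mul, one_mul]
    by_cases h1 : s < t <;> by_cases h2 : s < 0 <;>
      simp [h1, h2, Set.indicator, hk, ← not_lt, sub_eq_add_neg, add_comm]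
  calc greenSection σ U P h (σ t ω)
      = ∫ s, green U P 0 (s - t) (σ t ω) (h (σ (s - t) (σ t ω))) := by
        rw [integral_sub_right_eq_self
          (fun s => green U P 0 s (σ t ω) (h (σ s (σ t ω)))) t]
        rfl
    _ = ∫ s, U t ω (green U P 0 s ω (h (σ s ω)) +
        ((Ico 0 t).indicator k s - (Ico t 0).indicator k s)) := by simp_rw [hshift]
    _ = _ := by
        have i1 := (integrable_indicator_iff measurableSet_Ico).2 (hki 0 t)
        have i2 := (integrable_indicator_iff measurableSet_Ico).2 (hki t 0)
        have iJ := hH.integrable_green hU h ω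
        have iD : Integrable fun s => (Ico 0 t).indicator k s - (Ico t 0).indicator k s := i1.sub i2
        have e1 := integral_add iJ iD
        have e2 : ∫ s, ((Ico 0 t).indicator k s - (Ico t 0).indicator k s) =
            ∫ s in (0 : ℝ)..t, k s := by
          rw [integral_sub i1 i2, integral_indicator measurableSet_Ico,
            integral_indicator measurableSet_Ico, intervalIntegral, integral_Ico_eq_integral_Ioc,
            integral_Ico_eq_integral_Ioc]
        rw [e2] at e1
        refine (ContinuousLinearMap.integral_comp_comm (U t ω) (iJ.add iD)).trans ?_
        exact congrArg (U t ω) e1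

theorem IsHyperbolic.hasDerivAt_greenSection (hU : IsCauchyOperator σ A U)
    (hH : IsHyperbolic σ U P N ν) (h : C(Ω, E)) (ω : Ω) (t : ℝ) :
    HasDerivAt (fun t => greenSection σ U P h (σ t ω))
      (A (σ t ω) (greenSection σ U P h (σ t ω)) + h (σ t ω)) t := by
  have hσ : Continuous fun τ => σ τ ω := by fun_prop
  have hkc : Continuous fun s => U (-s) (σ s ω) (h (σ s ω)) :=
    (hU.continuous_time_inverse ω).clm_apply (h.continuous.comp hσ)
  have h1 := (hkc.integral_hasStrictDerivAt 0 t).hasDerivAt.const_add (greenSection σ U P h ω)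
  have h2 := ((hU ω).2 t).clm_apply h1
  have h3 : U t ω (U (-t) (σ t ω) (h (σ t ω))) = h (σ t ω) := by
    rw [← mul_apply_eq_comp, hU.mul_neg]
    rfl
  simp only [hH.greenSection_flow hU h _ ω]
  rw [h3] at h2
  exact h2

end Green

/-! ### The quasilinear equation: contraction in `C(Ω, E)`. -/

section Quasilinear

variable {Ω E : Type*} [MetricSpace Ω] [CompactSpace Ω]
  [NormedAddCommGroup E] [NormedSpace ℝ E] [CompleteSpace E] {σ : Flow ℝ Ω}
  {A : C(Ω, E →L[ℝ] E)} {U : ℝ → Ω → (E →L[ℝ] E)} {P : C(Ω, E →L[ℝ] E)} {N ν : ℝ}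

/-- The Green section as a continuous function. -/
noncomputable def IsHyperbolic.greenMap (hU : IsCauchyOperator σ A U)
    (hH : IsHyperbolic σ U P N ν) (h : C(Ω, E)) : C(Ω, E) :=
  ⟨greenSection σ U P h, hH.continuous_greenSection hU h⟩

theorem IsHyperbolic.norm_greenMap_le (hU : IsCauchyOperator σ A U)
    (hH : IsHyperbolic σ U P N ν) (h : C(Ω, E)) :
    ‖hH.greenMap hU h‖ ≤ 2 * N / ν * ‖h‖ := by
  have := hH.N_pos
  have := hH.nu_pos
  exact (ContinuousMap.norm_le _ (by positivity)).2 fun ω => hH.norm_greenSection_le hU h ω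

theorem IsHyperbolic.greenMap_sub (hU : IsCauchyOperator σ A U)
    (hH : IsHyperbolic σ U P N ν) (h₁ h₂ : C(Ω, E)) :
    hH.greenMap hU h₁ - hH.greenMap hU h₂ = hH.greenMap hU (h₁ - h₂) :=
  ContinuousMap.ext fun ω => hH.greenSection_sub hU h₁ h₂ ω

/-- The difference of two such sections solves the homogeneous equation along each orbit and is
bounded because `Ω` is compact, hence vanishes. -/
theorem IsHyperbolic.greenMap_unique (hU : IsCauchyOperator σ A U)
    (hH : IsHyperbolic σ U P N ν) {h w : C(Ω, E)}
    (hw : ∀ ω t, HasDerivAt (fun t => w (σ t ω)) (A (σ t ω) (w (σ t ω)) + h (σ t ω)) t) :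
    hH.greenMap hU h = w := by
  ext ω
  have h0 := hH.eq_zero_of_bounded hU (ω := ω)
    (z := fun t => hH.greenMap hU h (σ t ω) - w (σ t ω)) (C := ‖hH.greenMap hU h - w‖)
    (fun t => by
      have := (hH.hasDerivAt_greenSection hU h ω t).sub (hw ω t)
      rw [add_sub_add_right_eq_sub, ← map_sub] at this
      exact this)
    (fun t => (hH.greenMap hU h - w).norm_coe_le_norm (σ t ω))
  simpa [sub_eq_zero] using h0

theorem isInvariantSection_of_hasDerivAt {Ω E : Type*} [TopologicalSpace Ω]
    [NormedAddCommGroup E] [NormedSpace ℝ E] {σ : Flow ℝ Ω} {g : Ω → E → E} {D : Set E}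
    {u : C(Ω, E)} (hD : ∀ ω, u ω ∈ D)
    (hu : ∀ ω t, HasDerivAt (fun t => u (σ t ω)) (g (σ t ω) (u (σ t ω))) t)
    (huniq : ∀ ω (y z : ℝ → E), IsSolution σ g D ω y → IsSolution σ g D ω z → y 0 = z 0 →
      EqOn y z (Ici 0)) : IsInvariantSection σ g D u := by
  intro ω
  have hsol : IsSolution σ g D ω fun t => u (σ t ω) :=
    fun t _ => ⟨hD _, (hu ω t).hasDerivWithinAt⟩
  exact ⟨fun t => u (σ t ω), ⟨hsol, by simp,
    fun y hy hy0 => huniq ω _ _ hy hsol (by simpa using hy0)⟩,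
    fun _ _ => rfl⟩

theorem HasUniqueSolutions.eqOn {Ω E : Type*} [TopologicalSpace Ω]
    [NormedAddCommGroup E] [NormedSpace ℝ E] {σ : Flow ℝ Ω} {g : Ω → E → E}
    (h : HasUniqueSolutions σ g) (ω : Ω) (y z : ℝ → E) (hy : IsSolution σ g univ ω y)
    (hz : IsSolution σ g univ ω z) (h0 : y 0 = z 0) : EqOn y z (Ici 0) := by
  obtain ⟨ψ, -, -, hψ⟩ := h ω (y 0)
  exact (hψ y hy rfl).trans (hψ z hz h0.symm).symm

/-- With `K = 2N/ν`, the map has Lipschitz constant `K L < 1` on the ball of radius `r` around `γ`,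
and displaces `γ` by at most `K (K⁻¹ - L) r = r - K L r`, so the ball is mapped into itself. The
value `L = 0` is admitted so that `ε = 0` is covered in the perturbed equation. -/
theorem IsHyperbolic.exists_isInvariantSection (hU : IsCauchyOperator σ A U)
    (hH : IsHyperbolic σ U P N ν) (f : C(Ω, E)) {F : Ω → E → E} {L r : ℝ}
    (hF : Continuous (Function.uncurry F))
    (hsol : HasUniqueSolutions σ (fun ω x => A ω x + f ω + F ω x))
    (hL₀ : 0 ≤ L) (hL : L < ν / (2 * N)) (hr : 0 ≤ r)
    (hγ : ∀ ω, ‖F ω (greenSection σ U P f ω)‖ ≤ (ν / (2 * N) - L) * r)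
    (hLip : ∀ ω, ∀ x₁ ∈ Metric.cthickening r (range (greenSection σ U P f)),
        ∀ x₂ ∈ Metric.cthickening r (range (greenSection σ U P f)),
        ‖F ω x₁ - F ω x₂‖ ≤ L * ‖x₁ - x₂‖) :
    ∃ u : C(Ω, E), (∀ ω, u ω ∈ Metric.cthickening r (range (greenSection σ U P f))) ∧
      IsInvariantSection σ (fun ω x => A ω x + f ω + F ω x) univ u := by
  have hN := hH.N_pos
  have hν := hH.nu_pos
  set γ : C(Ω, E) := hH.greenMap hU f
  set K : ℝ := 2 * N / ν with hK
  have hK0 : 0 < K := by positivity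
  have hKinv : ν / (2 * N) = K⁻¹ := by rw [hK, inv_div]
  rw [hKinv] at hL hγ
  have hKL : K * L < 1 := by
    have := mul_lt_mul_of_pos_left hL hK0
    rwa [mul_inv_cancel₀ hK0.ne'] at this
  let Φ : C(Ω, E) → C(Ω, E) := fun v => ⟨fun ω => F ω (v ω),
    hF.comp (by fun_prop : Continuous fun ω => (ω, v ω))⟩
  let S : C(Ω, E) → C(Ω, E) := fun v => hH.greenMap hU (f + Φ v)
  have hmem : ∀ v ∈ Metric.closedBall γ r, ∀ ω,
      v ω ∈ Metric.cthickening r (range (greenSection σ U P f)) := fun v hv ω =>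
    Metric.mem_cthickening_of_dist_le _ _ _ _ (mem_range_self ω)
      ((ContinuousMap.dist_apply_le_dist ω).trans hv)
  have hΦ : ∀ v ∈ Metric.closedBall γ r, ∀ w ∈ Metric.closedBall γ r,
      ‖Φ v - Φ w‖ ≤ L * ‖v - w‖ := fun v hv w hw =>
    (ContinuousMap.norm_le _ (by positivity)).2 fun ω =>
      (hLip ω _ (hmem v hv ω) _ (hmem w hw ω)).trans
        (mul_le_mul_of_nonneg_left ((v - w).norm_coe_le_norm ω) hL₀)
  have hSsub : ∀ v w, S v - S w = hH.greenMap hU (Φ v - Φ w) := fun v w => by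
    change hH.greenMap hU _ - hH.greenMap hU _ = _
    rw [hH.greenMap_sub hU, add_sub_add_left_eq_sub]
  have hγmem : γ ∈ Metric.closedBall γ r := Metric.mem_closedBall_self hr
  have hmaps : MapsTo S (Metric.closedBall γ r) (Metric.closedBall γ r) := by
    intro v hv
    have h1 : S v - γ = hH.greenMap hU (Φ v) := by
      change hH.greenMap hU _ - hH.greenMap hU _ = _
      rw [hH.greenMap_sub hU, add_sub_cancel_left]
    have h2 : ‖Φ γ‖ ≤ (K⁻¹ - L) * r :=
      (ContinuousMap.norm_le _ (mul_nonneg (sub_pos.2 hL).le hr)).2 hγ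
    have h3 : ‖Φ v‖ ≤ K⁻¹ * r := by
      have h4 := hΦ v hv γ hγmem
      rw [mem_closedBall_iff_norm] at hv
      have h5 : ‖Φ v‖ ≤ ‖Φ v - Φ γ‖ + ‖Φ γ‖ := by simpa using norm_add_le (Φ v - Φ γ) (Φ γ)
      nlinarith [mul_le_mul_of_nonneg_left hv hL₀]
    rw [mem_closedBall_iff_norm, h1]
    refine (hH.norm_greenMap_le hU _).trans ((mul_le_mul_of_nonneg_left h3 hK0.le).trans_eq ?_)
    rw [← mul_assoc, mul_inv_cancel₀ hK0.ne', one_mul]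
  obtain ⟨u, hu, hfix⟩ := exists_fixedPoint_of_iterate Metric.isClosed_closedBall ⟨γ, hγmem⟩
    hmaps 1 (by positivity) hKL fun v hv w hw => by
      simp only [Function.iterate_one]
      rw [dist_eq_norm, dist_eq_norm, hSsub, mul_assoc]
      exact (hH.norm_greenMap_le hU _).trans (mul_le_mul_of_nonneg_left (hΦ v hv w hw) hK0.le)
  refine ⟨u, hmem u hu, isInvariantSection_of_hasDerivAt (fun _ => trivial) (fun ω t => ?_)
    hsol.eqOn⟩
  have h1 := hH.hasDerivAt_greenSection hU (f + Φ u) ω t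
  have h2 : ∀ ω, greenSection σ U P (f + Φ u) ω = u ω := fun ω => DFunLike.congr_fun hfix ω
  simp only [h2] at h1
  rw [ContinuousMap.add_apply, ← add_assoc] at h1
  exact h1

end Quasilinear

/-! ### Integrals depending on a parameter, and contour integrals. -/

theorem hasDerivAt_intervalIntegral_of_continuous {V : Type*} [NormedAddCommGroup V]
    [NormedSpace ℝ V] {F F' : ℝ → ℝ → V} (hF : ∀ t, Continuous (F t))
    (hF' : Continuous (Function.uncurry F')) (hd : ∀ t θ, HasDerivAt (fun t => F t θ) (F' t θ) t)
    (a b t : ℝ) : HasDerivAt (fun t => ∫ θ in a..b, F t θ) (∫ θ in a..b, F' t θ) t := by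
  obtain ⟨C, hC⟩ := (isCompact_Icc.prod isCompact_uIcc).exists_bound_of_continuousOn
    (s := Icc (t - 1) (t + 1) ×ˢ uIcc a b) hF'.continuousOn
  refine (intervalIntegral.hasDerivAt_integral_of_dominated_loc_of_deriv_le (F' := F')
    (bound := fun _ => C) (Icc_mem_nhds (sub_one_lt t) (lt_add_one t))
    (Eventually.of_forall fun s => (hF s).aestronglyMeasurable)
    ((hF t).intervalIntegrable a b) ?_ ?_ intervalIntegrable_const
    (Eventually.of_forall fun θ _ s _ => hd s θ)).2
  · exact (hF'.comp (by fun_prop : Continuous fun θ : ℝ => (t, θ))).aestronglyMeasurable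
  · exact Eventually.of_forall fun θ hθ s hs => hC (s, θ) ⟨hs, uIoc_subset_uIcc hθ⟩

theorem ContinuousLinearMap.circleIntegral_comp_comm {V W : Type*} [NormedAddCommGroup V]
    [NormedSpace ℂ V] [CompleteSpace V] [NormedAddCommGroup W] [NormedSpace ℂ W] [CompleteSpace W]
    (T : V →L[ℂ] W) {f : ℂ → V} {c : ℂ} {R : ℝ} (hf : CircleIntegrable f c R) :
    (∮ z in C(c, R), T (f z)) = T (∮ z in C(c, R), f z) := by
  simp only [circleIntegral]
  rw [← T.intervalIntegral_comp_comm hf.out]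
  simp

/-! ### The stable part of an exponential via the Cayley transform. -/

section Cayley

variable {B : Type*} [NormedRing B] [NormedAlgebra ℂ B]

/-- The Cayley transform `(c - a)⁻¹ (c + a)`. -/
noncomputable def cayley (c : ℝ) (a : B) : B :=
  Ring.inverse (algebraMap ℂ B c - a) * (algebraMap ℂ B c + a)

/-- The inverse Cayley transform `c (z - 1) / (z + 1)` on complex numbers. -/
noncomputable def cayleyInv (c : ℝ) (z : ℂ) : ℂ := c * ((z - 1) / (z + 1))

theorem sub_mul_cayley {c : ℝ} {a : B} (h : IsUnit (algebraMap ℂ B c - a)) :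
    (algebraMap ℂ B c - a) * cayley c a = algebraMap ℂ B c + a := by
  rw [cayley, ← mul_assoc, Ring.mul_inverse_cancel _ h, one_mul]

theorem cayleyInv_re {c : ℝ} {z : ℂ} :
    (cayleyInv c z).re = c * (Complex.normSq z - 1) / Complex.normSq (z + 1) := by
  simp [cayleyInv, Complex.div_re, Complex.normSq_apply]
  ring

/-- Up to the invertible factors `c - a` and `z + 1`, this exchanges `z - cayley c a` for `w - a`
with `w = cayleyInv c z`. The unit circle corresponds to the imaginary axis and the open disc to the
left half-plane. -/
theorem sub_mul_sub_cayley {c : ℝ} {a : B} (h : IsUnit (algebraMap ℂ B c - a)) {z : ℂ}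
    (hz : z ≠ -1) : (algebraMap ℂ B c - a) * (algebraMap ℂ B z - cayley c a) =
      (z + 1) • (algebraMap ℂ B (cayleyInv c z) - a) := by
  have hz' : z + 1 ≠ 0 := fun h => hz (eq_neg_of_add_eq_zero_left h)
  have h1 : (z + 1) * cayleyInv c z = c * (z - 1) := by
    rw [cayleyInv]
    field_simp
  rw [mul_sub, sub_mul_cayley h]
  simp only [Algebra.algebraMap_eq_smul_one, mul_smul_comm, mul_one, smul_sub, smul_smul, h1]
  module

theorem commute_algebraMap_sub (z : ℂ) (a : B) : Commute a (algebraMap ℂ B z - a) :=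
  (Algebra.commute_algebraMap_right z a).sub_right (Commute.refl a)

theorem Commute.ringInverse_right {R : Type*} [MonoidWithZero R] {a x : R} (h : Commute a x)
    (hx : IsUnit x) : Commute a (Ring.inverse x) := by
  obtain ⟨u, rfl⟩ := hx
  rw [Ring.inverse_unit]
  exact h.units_inv_right

theorem commute_cayley {c : ℝ} {a : B} (h : IsUnit (algebraMap ℂ B c - a)) :
    Commute a (cayley c a) :=
  ((commute_algebraMap_sub _ a).ringInverse_right h).mul_right
    ((Algebra.commute_algebraMap_right _ a).add_right (Commute.refl a))

theorem commute_resolvent_cayley {c : ℝ} {a : B} (h : IsUnit (algebraMap ℂ B c - a)) {z : ℂ}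
    (hz : z ∈ resolventSet ℂ (cayley c a)) : Commute a (resolvent (cayley c a) z) :=
  Commute.ringInverse_right ((Algebra.commute_algebraMap_right _ a).sub_right (commute_cayley h)) hz

theorem cayley_mul_cayley_neg {c : ℝ} {a : B} (h : IsUnit (algebraMap ℂ B c - a))
    (h' : IsUnit (algebraMap ℂ B c + a)) : cayley c a * cayley c (-a) = 1 := by
  rw [cayley, cayley, sub_neg_eq_add, ← sub_eq_add_neg, mul_assoc, ← mul_assoc _ (Ring.inverse _),
    Ring.mul_inverse_cancel _ h', one_mul, Ring.inverse_mul_cancel _ h]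

theorem mem_resolventSet_cayley {c : ℝ} (hc : 0 < c) {a : B}
    (h : IsUnit (algebraMap ℂ B c - a)) (hspec : ∀ z ∈ spectrum ℂ a, z.re ≠ 0) {z : ℂ}
    (hz : ‖z‖ = 1) : z ∈ resolventSet ℂ (cayley c a) := by
  rw [spectrum.mem_resolventSet_iff]
  obtain ⟨u, hu⟩ := h
  rw [← Units.isUnit_units_mul u, hu]
  have h : IsUnit (algebraMap ℂ B c - a) := ⟨u, hu⟩
  -- The point `-1` corresponds to `w = ∞`; there the product reduces to the nonzero scalar `-2c`.
  by_cases h1 : z = -1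
  · have h2 : (algebraMap ℂ B c - a) * (algebraMap ℂ B z - cayley c a) =
        algebraMap ℂ B (-(2 * c)) := by
      rw [mul_sub, sub_mul_cayley h, h1]
      simp only [Algebra.algebraMap_eq_smul_one, mul_smul_comm, mul_one, smul_sub, smul_smul]
      module
    rw [h2]
    refine IsUnit.map (algebraMap ℂ B) (IsUnit.mk0 _ ?_)
    simpa using hc.ne'
  · rw [sub_mul_sub_cayley h h1]
    have hz' : z + 1 ≠ 0 := fun h => h1 (eq_neg_of_add_eq_zero_left h)
    have h3 : cayleyInv c z ∉ spectrum ℂ a := fun h4 => hspec _ h4 (by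
      rw [cayleyInv_re, Complex.normSq_eq_norm_sq, hz]
      simp)
    rw [spectrum.notMem_iff] at h3
    exact h3.smul (Units.mk0 _ hz')

/-- Under the contour integral, multiplication by `w` becomes multiplication by `a`: the extra term
is a constant element times a scalar function holomorphic away from `-1`, which integrates to zero
over a circle of radius less than `1`. -/
theorem mul_resolvent_cayley {c : ℝ} {a : B} (h : IsUnit (algebraMap ℂ B c - a)) {z : ℂ}
    (hz : z ∈ resolventSet ℂ (cayley c a)) (h1 : z ≠ -1) :
    cayleyInv c z • resolvent (cayley c a) z = a * resolvent (cayley c a) z +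
      (z + 1)⁻¹ • (algebraMap ℂ B c - a) := by
  have hz' : z + 1 ≠ 0 := fun h => h1 (eq_neg_of_add_eq_zero_left h)
  have h2 := congrArg (fun x => (z + 1)⁻¹ • (x * resolvent (cayley c a) z))
    (sub_mul_sub_cayley h h1)
  simp only [smul_mul_assoc, smul_smul, inv_mul_cancel₀ hz', one_smul, mul_assoc] at h2
  rw [resolvent, Ring.mul_inverse_cancel _ hz, mul_one, sub_mul, ← Algebra.smul_def] at h2
  rw [resolvent, h2]
  abel

/-- The spectrum is compact and misses the unit circle, hence misses a closed annulus inside it. The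
lower limit `1 / 2` in the choice of `s` keeps the radius positive. -/
theorem exists_radius [CompleteSpace B] {m : B} (hm : ∀ z : ℂ, ‖z‖ = 1 → z ∈ resolventSet ℂ m) :
    ∃ s : ℝ, 0 < s ∧ s < 1 ∧ ∀ z : ℂ, s ≤ ‖z‖ → ‖z‖ ≤ 1 → z ∈ resolventSet ℂ m := by
  have hclosed : IsClosed (norm '' spectrum ℂ m) :=
    ((spectrum.isCompact m).image continuous_norm).isClosed
  have h1 : (1 : ℝ) ∈ (norm '' spectrum ℂ m)ᶜ := by
    rintro ⟨z, hz, hz1⟩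
    exact hz (hm z hz1)
  obtain ⟨ε, hε, hball⟩ := Metric.isOpen_iff.1 hclosed.isOpen_compl 1 h1
  refine ⟨max (1 - ε / 2) (1 / 2), by positivity, max_lt (by linarith) (by norm_num),
    fun z hz hz1 => ?_⟩
  by_contra hcon
  have h2 : ‖z‖ ∈ Metric.ball (1 : ℝ) ε := by
    rw [Metric.mem_ball, Real.dist_eq, abs_lt]
    constructor <;> linarith [(le_max_left _ _).trans hz]
  exact hball h2 ⟨z, hcon, rfl⟩

/-- Decay of `exp (t a)` on the stable part, as a contour integral. -/
theorem exists_stable_semigroup [CompleteSpace B] {c : ℝ} (hc : 0 < c) {a : B}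
    (h : IsUnit (algebraMap ℂ B c - a)) (hspec : ∀ z ∈ spectrum ℂ a, z.re ≠ 0) :
    ∃ (G : ℝ → B) (C δ : ℝ), 0 ≤ C ∧ 0 < δ ∧ (∀ t, HasDerivAt G (a * G t) t) ∧
      (∀ t, 0 ≤ t → ‖G t‖ ≤ C * Real.exp (-δ * t)) ∧ Commute a (G 0) ∧
      G 0 = (2 * Real.pi * Complex.I : ℂ)⁻¹ • ∮ z in C(0, 1), resolvent (cayley c a) z := by
  obtain ⟨s, hs0, hs1, hs⟩ := exists_radius fun z hz => mem_resolventSet_cayley hc h hspec hz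
  set R : ℂ → B := resolvent (cayley c a) with hR
  have hRd : ∀ z : ℂ, s ≤ ‖z‖ → ‖z‖ ≤ 1 → DifferentiableAt ℂ R z := fun z h1 h2 =>
    (spectrum.hasDerivAt_resolvent_const_left (hs z h1 h2)).differentiableAt
  have hsph : ∀ z ∈ Metric.sphere (0 : ℂ) s, ‖z‖ = s := fun z hz => by simpa using hz
  have hne : ∀ z : ℂ, ‖z‖ = s → z ≠ -1 := by
    rintro z hz rfl
    simp at hz
    linarith
  have hne' : ∀ z : ℂ, ‖z‖ = s → z + 1 ≠ 0 := fun z hz h => hne z hz (eq_neg_of_add_eq_zero_left h)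
  have hRc : ContinuousOn R (Metric.sphere 0 s) := fun z hz =>
    (hRd z (hsph z hz).ge ((hsph z hz).trans_le hs1.le)).continuousAt.continuousWithinAt
  have hlc : ContinuousOn (cayleyInv c) (Metric.sphere 0 s) := by
    refine continuousOn_const.mul ((continuousOn_id.sub continuousOn_const).div
      (continuousOn_id.add continuousOn_const) fun z hz => hne' z (hsph z hz))
  obtain ⟨C, hC⟩ := (isCompact_sphere (0 : ℂ) s).exists_bound_of_continuousOn hRc
  have hmem : ∀ θ, circleMap 0 s θ ∈ Metric.sphere (0 : ℂ) s := circleMap_mem_sphere _ hs0.le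
  have hzc := continuous_circleMap 0 s
  have hRz : Continuous fun θ => R (circleMap 0 s θ) := hRc.comp_continuous hzc hmem
  have hlz : Continuous fun θ => cayleyInv c (circleMap 0 s θ) := hlc.comp_continuous hzc hmem
  have hdz : Continuous fun θ => deriv (circleMap 0 s) θ := by
    simp only [deriv_circleMap]
    fun_prop
  have hec : ∀ t : ℝ, ContinuousOn (fun z => Complex.exp (t * cayleyInv c z))
      (Metric.sphere 0 s) := fun t => (continuousOn_const.mul hlc).cexp
  have hint : ∀ t : ℝ, CircleIntegrable (fun z => Complex.exp (t * cayleyInv c z) • R z) 0 s :=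
    fun t => ((hec t).smul hRc).circleIntegrable hs0.le
  -- The circle of radius `s < 1` lies strictly inside the disc, so `Re w` is negative and bounded
  -- away from `0` on it; the unit circle would give no decay and meets the singularity of
  -- `cayleyInv` at `-1`.
  let G : ℝ → B := fun t => (2 * Real.pi * Complex.I : ℂ)⁻¹ •
    ∮ z in C(0, s), Complex.exp (t * cayleyInv c z) • R z
  have hG0 : G 0 = (2 * Real.pi * Complex.I : ℂ)⁻¹ • ∮ z in C(0, s), R z := by
    simp [G]
  refine ⟨G, s * C, c * ((1 - s) / (1 + s)), ?_, by
    have := sub_pos.2 hs1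
    positivity, fun t => ?_, fun t ht => ?_, ?_, ?_⟩
  · exact mul_nonneg hs0.le ((norm_nonneg _).trans (hC _ (hmem 0)))
  · have h1 : HasDerivAt (fun t : ℝ => ∮ z in C(0, s), Complex.exp (t * cayleyInv c z) • R z)
        (∮ z in C(0, s), (cayleyInv c z * Complex.exp (t * cayleyInv c z)) • R z) t := by
      refine hasDerivAt_intervalIntegral_of_continuous
        (F := fun t θ => deriv (circleMap 0 s) θ •
          (Complex.exp (t * cayleyInv c (circleMap 0 s θ)) • R (circleMap 0 s θ)))
        (F' := fun t θ => deriv (circleMap 0 s) θ • ((cayleyInv c (circleMap 0 s θ) *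
          Complex.exp (t * cayleyInv c (circleMap 0 s θ))) • R (circleMap 0 s θ)))
        (fun t => ?_) ?_ (fun t θ => ?_) 0 (2 * Real.pi) t
      · exact hdz.smul ((continuous_const.mul hlz).cexp.smul hRz)
      · simp only [Function.uncurry_def]
        have e1 := hdz.comp (continuous_snd (X := ℝ) (Y := ℝ))
        have e2 := hlz.comp (continuous_snd (X := ℝ) (Y := ℝ))
        have e3 := hRz.comp (continuous_snd (X := ℝ) (Y := ℝ))
        exact e1.smul ((e2.mul ((Complex.continuous_ofReal.comp continuous_fst).mul e2).cexp).smul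
          e3)
      · have e1 : HasDerivAt (fun t : ℝ => (t : ℂ) * cayleyInv c (circleMap 0 s θ))
            (cayleyInv c (circleMap 0 s θ)) t := by
          simpa using (Complex.ofRealCLM.hasDerivAt (x := t)).mul_const
            (cayleyInv c (circleMap 0 s θ))
        have e2 := ((e1.cexp.smul_const (R (circleMap 0 s θ))).const_smul
          (deriv (circleMap 0 s) θ))
        rwa [mul_comm (Complex.exp _)] at e2
    have h2 : (∮ z in C(0, s), (cayleyInv c z * Complex.exp (t * cayleyInv c z)) • R z) =
        a * ∮ z in C(0, s), Complex.exp (t * cayleyInv c z) • R z := by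
      have e1 : (∮ z in C(0, s), (cayleyInv c z * Complex.exp (t * cayleyInv c z)) • R z) =
          ∮ z in C(0, s), (a * (Complex.exp (t * cayleyInv c z) • R z) +
            (Complex.exp (t * cayleyInv c z) * (z + 1)⁻¹) • (algebraMap ℂ B c - a)) := by
        refine circleIntegral.integral_congr hs0.le fun z hz => ?_
        have hz' := hsph z hz
        change _ • _ = _
        rw [mul_comm, ← smul_smul, mul_resolvent_cayley h (hs z hz'.ge (hz'.trans_le hs1.le))
          (hne z hz'), smul_add, smul_smul, mul_smul_comm]
      have hint2 : CircleIntegrable (fun z : ℂ => (Complex.exp (t * cayleyInv c z) * (z + 1)⁻¹) •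
          (algebraMap ℂ B c - a)) 0 s :=
        (((hec t).mul ((continuousOn_id.add continuousOn_const).inv₀
          fun z hz => hne' z (hsph z hz))).smul continuousOn_const).circleIntegrable hs0.le
      have e2 : (∮ z in C(0, s), (Complex.exp (t * cayleyInv c z) * (z + 1)⁻¹)) = 0 := by
        have hne2 : ∀ z ∈ Metric.closedBall (0 : ℂ) s, z + 1 ≠ 0 := by
          intro z hz h
          rw [mem_closedBall_zero_iff, eq_neg_of_add_eq_zero_left h, norm_neg, norm_one] at hz
          linarith
        have hd : DifferentiableOn ℂ (fun z => Complex.exp (t * cayleyInv c z) * (z + 1)⁻¹)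
            (Metric.closedBall 0 s) := by
          intro z hz
          have := hne2 z hz
          unfold cayleyInv
          refine DifferentiableAt.differentiableWithinAt ?_
          fun_prop (disch := assumption)
        exact Complex.circleIntegral_eq_zero_of_differentiable_on_off_countable hs0.le
          countable_empty hd.continuousOn fun z hz =>
            (hd z (Metric.ball_subset_closedBall hz.1)).differentiableAt
              (Filter.mem_of_superset (Metric.isOpen_ball.mem_nhds hz.1)
                Metric.ball_subset_closedBall)
      have hint3 : CircleIntegrable (fun z => a * (Complex.exp (t * cayleyInv c z) • R z)) 0 s :=
        (continuousOn_const.mul ((hec t).smul hRc)).circleIntegrable hs0.le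
      rw [e1, circleIntegral.integral_add hint3 hint2, circleIntegral.integral_smul_const, e2,
        zero_smul, add_zero]
      exact (ContinuousLinearMap.mul ℂ B a).circleIntegral_comp_comm (hint t)
    rw [h2] at h1
    have h3 := h1.const_smul (2 * Real.pi * Complex.I : ℂ)⁻¹
    rw [← mul_smul_comm] at h3
    exact h3
  · have h1 : ∀ z ∈ Metric.sphere (0 : ℂ) s, ‖Complex.exp (t * cayleyInv c z) • R z‖ ≤
        Real.exp (-(c * ((1 - s) / (1 + s))) * t) * C := by
      intro z hz
      rw [norm_smul, Complex.norm_exp]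
      refine mul_le_mul (Real.exp_le_exp.2 ?_) (hC z hz) (norm_nonneg _) (Real.exp_nonneg _)
      -- On `|z| = s`, `Re w = c (s² - 1) / |z + 1|²` is largest where `|z + 1|` is largest, namely
      -- `1 + s`; this is the decay rate.
      have h2 : (cayleyInv c z).re ≤ -(c * ((1 - s) / (1 + s))) := by
        have h3 : Complex.normSq (z + 1) ≤ (1 + s) ^ 2 := by
          rw [Complex.normSq_eq_norm_sq]
          have := norm_add_le z 1
          rw [hsph z hz, norm_one] at this
          exact pow_le_pow_left₀ (norm_nonneg _) (by linarith) 2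
        have h4 : 0 < Complex.normSq (z + 1) := Complex.normSq_pos.2 (hne' z (hsph z hz))
        rw [cayleyInv_re, Complex.normSq_eq_norm_sq, hsph z hz, div_le_iff₀ h4]
        have h5 : c * ((1 - s) / (1 + s)) * Complex.normSq (z + 1) ≤
            c * ((1 - s) / (1 + s)) * (1 + s) ^ 2 := by
          have := sub_pos.2 hs1
          exact mul_le_mul_of_nonneg_left h3 (by positivity)
        have h6 : c * ((1 - s) / (1 + s)) * (1 + s) ^ 2 = -(c * (s ^ 2 - 1)) := by
          field_simp
          ring
        linarith
      simp only [Complex.re_ofReal_mul]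
      nlinarith
    refine (circleIntegral.norm_two_pi_i_inv_smul_integral_le_of_norm_le_const hs0.le
      h1).trans_eq ?_
    ring
  · rw [hG0]
    have hRint : CircleIntegrable R 0 s := hRc.circleIntegrable hs0.le
    refine Commute.smul_right ?_ _
    have e1 := (ContinuousLinearMap.mul ℂ B a).circleIntegral_comp_comm hRint
    have e2 := ((ContinuousLinearMap.mul ℂ B).flip a).circleIntegral_comp_comm hRint
    have e3 : (∮ z in C(0, s), ContinuousLinearMap.mul ℂ B a (R z)) =
        ∮ z in C(0, s), (ContinuousLinearMap.mul ℂ B).flip a (R z) :=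
      circleIntegral.integral_congr hs0.le fun z hz => commute_resolvent_cayley h
        (hs z (hsph z hz).ge ((hsph z hz).trans_le hs1.le))
    rw [e1, e2] at e3
    exact e3
  · rw [hG0]
    congr 1
    -- The annulus between the two circles contains no spectrum, so the contour can be moved to
    -- radius `1`, where the projections for `a` and `-a` can be compared.
    have hmem' : ∀ z ∈ Metric.closedBall (0 : ℂ) 1 \ Metric.ball 0 s, s ≤ ‖z‖ ∧ ‖z‖ ≤ 1 :=
      fun z hz => ⟨by simpa using hz.2, by simpa using hz.1⟩
    refine (Complex.circleIntegral_eq_of_differentiable_on_annulus_off_countable hs0 hs1.le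
      countable_empty (fun z hz => ?_) (fun z hz => ?_)).symm
    · exact (hRd z (hmem' z hz).1 (hmem' z hz).2).continuousAt.continuousWithinAt
    · have := hmem' z ⟨Metric.ball_subset_closedBall hz.1.1,
        fun h => hz.1.2 (Metric.ball_subset_closedBall h)⟩
      exact hRd z this.1 this.2

end Cayley

/-! ### The stable parts of `a` and `-a` add up to the identity. -/

section CayleySum

variable {B : Type*} [NormedRing B] [NormedAlgebra ℂ B]

/-- Since `m' = m⁻¹`, `(z⁻¹ - m')⁻¹ = -z m (z - m)⁻¹`, and the sum collapses to `(z - m)(z - m)⁻¹`.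
-/
theorem smul_resolvent_add_inv_smul_resolvent {m m' : B} (h : m * m' = 1) (h' : m' * m = 1)
    {z : ℂ} (hz : z ≠ 0) (hm : z ∈ resolventSet ℂ m) :
    z • resolvent m z + z⁻¹ • resolvent m' z⁻¹ = 1 := by
  have h1 : (algebraMap ℂ B z - m) * resolvent m z = 1 := Ring.mul_inverse_cancel _ hm
  have h2 : resolvent m z * (algebraMap ℂ B z - m) = 1 := Ring.inverse_mul_cancel _ hm
  have h3 : Commute m (resolvent m z) :=
    Commute.ringInverse_right (commute_algebraMap_sub z m) hm
  have e : (algebraMap ℂ B z⁻¹ - m') * m = -(z⁻¹ • (algebraMap ℂ B z - m)) := by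
    rw [sub_mul, h', ← Algebra.smul_def, smul_sub, Algebra.algebraMap_eq_smul_one, smul_smul,
      inv_mul_cancel₀ hz]
    simp
  have e' : m * (algebraMap ℂ B z⁻¹ - m') = -(z⁻¹ • (algebraMap ℂ B z - m)) := by
    rw [mul_sub, h, ← Algebra.commutes, ← Algebra.smul_def, smul_sub,
      Algebra.algebraMap_eq_smul_one, smul_smul, inv_mul_cancel₀ hz]
    simp
  have h4 : resolvent m' z⁻¹ = -(z • (m * resolvent m z)) := by
    let u : Bˣ := ⟨algebraMap ℂ B z⁻¹ - m', -(z • (m * resolvent m z)), by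
      rw [mul_neg, mul_smul_comm, ← mul_assoc, e, neg_mul, smul_mul_assoc, h1, smul_neg, smul_smul,
        mul_inv_cancel₀ hz, one_smul, neg_neg], by
      rw [neg_mul, smul_mul_assoc, h3.eq, mul_assoc, e', mul_neg, mul_smul_comm, h2, smul_neg,
        smul_smul, mul_inv_cancel₀ hz, one_smul, neg_neg]⟩
    exact Ring.inverse_unit u
  rw [h4, smul_neg, smul_smul, inv_mul_cancel₀ hz, one_smul, ← sub_eq_add_neg,
    Algebra.smul_def, ← sub_mul, h1]

theorem two_pi_I_inv_smul_circleIntegral (f : ℂ → B) :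
    ((2 * Real.pi * Complex.I : ℂ)⁻¹ • ∮ z in C(0, 1), f z) =
      (2 * Real.pi : ℂ)⁻¹ • ∫ θ in (0 : ℝ)..2 * Real.pi, circleMap 0 1 θ • f (circleMap 0 1 θ) := by
  have h : ∀ θ : ℝ, deriv (circleMap 0 1) θ • f (circleMap 0 1 θ) =
      Complex.I • (circleMap 0 1 θ • f (circleMap 0 1 θ)) := fun θ => by
    rw [deriv_circleMap, smul_smul, mul_comm]
  rw [circleIntegral]
  simp_rw [h]
  rw [intervalIntegral.integral_smul, smul_smul, mul_inv, mul_assoc,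
    inv_mul_cancel₀ Complex.I_ne_zero, mul_one]

/-- The substitution `θ ↦ 2π - θ` replaces `z` by `z⁻¹` in the second integral, after which the
integrands add up to the constant `1`. -/
theorem circleIntegral_resolvent_add [CompleteSpace B] {m m' : B} (h : m * m' = 1)
    (h' : m' * m = 1) (hm : ∀ z : ℂ, ‖z‖ = 1 → z ∈ resolventSet ℂ m)
    (hm' : ∀ z : ℂ, ‖z‖ = 1 → z ∈ resolventSet ℂ m') :
    ((2 * Real.pi * Complex.I : ℂ)⁻¹ • ∮ z in C(0, 1), resolvent m z) +
      ((2 * Real.pi * Complex.I : ℂ)⁻¹ • ∮ z in C(0, 1), resolvent m' z) = 1 := by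
  have hn : ∀ θ, ‖circleMap 0 1 θ‖ = 1 := fun θ => by simp
  have hcont : ∀ x : B, (∀ z : ℂ, ‖z‖ = 1 → z ∈ resolventSet ℂ x) →
      Continuous fun θ => circleMap 0 1 θ • resolvent x (circleMap 0 1 θ) := fun x hx =>
    (continuous_circleMap 0 1).smul (continuous_iff_continuousAt.2 fun θ =>
      ((spectrum.hasDerivAt_resolvent_const_left (hx _ (hn θ))).continuousAt.comp
        (continuous_circleMap 0 1).continuousAt))
  have hrefl : ∀ θ : ℝ, circleMap 0 1 (2 * Real.pi - θ) = (circleMap 0 1 θ)⁻¹ := fun θ => by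
    simp only [circleMap_zero, Complex.ofReal_one, one_mul, ← Complex.exp_neg]
    push_cast
    rw [sub_mul, Complex.exp_sub, Complex.exp_two_pi_mul_I, Complex.exp_neg, one_div]
  rw [two_pi_I_inv_smul_circleIntegral, two_pi_I_inv_smul_circleIntegral]
  have h2 : (∫ θ in (0 : ℝ)..2 * Real.pi, circleMap 0 1 θ • resolvent m' (circleMap 0 1 θ)) =
      ∫ θ in (0 : ℝ)..2 * Real.pi, (circleMap 0 1 θ)⁻¹ • resolvent m' (circleMap 0 1 θ)⁻¹ := by
    have := intervalIntegral.integral_comp_sub_left (a := 0) (b := 2 * Real.pi)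
      (fun θ => circleMap 0 1 θ • resolvent m' (circleMap 0 1 θ)) (2 * Real.pi)
    simp only [sub_self, sub_zero, hrefl] at this
    exact this.symm
  have hc2 : Continuous fun θ => (circleMap 0 1 θ)⁻¹ • resolvent m' (circleMap 0 1 θ)⁻¹ := by
    simp only [← hrefl]
    exact (hcont m' hm').comp (continuous_const.sub continuous_id)
  rw [h2, ← smul_add, ← intervalIntegral.integral_add ((hcont m hm).intervalIntegrable _ _)
    (hc2.intervalIntegrable _ _)]
  have h3 : ∀ θ, circleMap 0 1 θ • resolvent m (circleMap 0 1 θ) +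
      (circleMap 0 1 θ)⁻¹ • resolvent m' (circleMap 0 1 θ)⁻¹ = 1 := fun θ =>
    smul_resolvent_add_inv_smul_resolvent h h' (by simp [circleMap]) (hm _ (hn θ))
  simp only [h3]
  rw [intervalIntegral.integral_const, sub_zero, ← Complex.coe_smul, smul_smul]
  push_cast
  rw [inv_mul_cancel₀ (by simp), one_smul]

/-- Exponential splitting for an element of a complex Banach algebra whose spectrum does not meet
the imaginary axis. -/
theorem exists_exponential_splitting [CompleteSpace B] {a : B}
    (hspec : ∀ z ∈ spectrum ℂ a, z.re ≠ 0) :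
    ∃ (G H : ℝ → B) (C δ : ℝ), 0 ≤ C ∧ 0 < δ ∧ (∀ t, HasDerivAt G (a * G t) t) ∧
      (∀ t, HasDerivAt H (-a * H t) t) ∧ (∀ t, 0 ≤ t → ‖G t‖ ≤ C * Real.exp (-δ * t)) ∧
      (∀ t, 0 ≤ t → ‖H t‖ ≤ C * Real.exp (-δ * t)) ∧ Commute a (G 0) ∧ G 0 + H 0 = 1 := by
  -- The norm of `1` is not assumed to be `1`, whence the factor `‖1‖`. The same `c` serves `a` and
  -- `-a`, so that their Cayley transforms are mutually inverse.
  set c : ℝ := ‖a‖ * ‖(1 : B)‖ + 1 with hcdef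
  have hc : 0 < c := by positivity
  have hu : ∀ b : B, ‖b‖ = ‖a‖ → IsUnit (algebraMap ℂ B c - b) := fun b hb => by
    have : (c : ℂ) ∈ resolventSet ℂ b := spectrum.mem_resolventSet_of_norm_lt_mul (by
      rw [Complex.norm_real, Real.norm_of_nonneg hc.le, hb, hcdef]
      exact lt_add_one _)
    exact this
  have h1 := hu a rfl
  have h2 := hu (-a) (norm_neg a)
  have hspec' : ∀ z ∈ spectrum ℂ (-a), z.re ≠ 0 := by
    intro z hz
    rw [← spectrum.neg_eq, Set.mem_neg] at hz
    simpa using hspec _ hz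
  obtain ⟨G, C₁, δ₁, hC₁, hδ₁, hG, hGb, hGc, hG0⟩ := exists_stable_semigroup hc h1 hspec
  obtain ⟨H, C₂, δ₂, hC₂, hδ₂, hH, hHb, -, hH0⟩ := exists_stable_semigroup hc h2 hspec'
  have hmul := cayley_mul_cayley_neg h1 (by simpa using h2)
  have hmul' := cayley_mul_cayley_neg h2 (by simpa [← sub_eq_add_neg] using h1)
  rw [neg_neg] at hmul'
  have key : ∀ {C δ t : ℝ}, 0 ≤ C → C ≤ max C₁ C₂ → min δ₁ δ₂ ≤ δ → 0 ≤ t →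
      C * Real.exp (-δ * t) ≤ max C₁ C₂ * Real.exp (-min δ₁ δ₂ * t) := by
    intro C δ t h0 h1 h2 ht
    have : -δ * t ≤ -min δ₁ δ₂ * t := mul_le_mul_of_nonneg_right (neg_le_neg h2) ht
    exact mul_le_mul h1 (Real.exp_le_exp.2 this) (Real.exp_nonneg _) (h0.trans h1)
  refine ⟨G, H, max C₁ C₂, min δ₁ δ₂, le_max_of_le_left hC₁, lt_min hδ₁ hδ₂, hG, hH,
    fun t ht => (hGb t ht).trans (key hC₁ (le_max_left _ _) (min_le_left _ _) ht),
    fun t ht => (hHb t ht).trans (key hC₂ (le_max_right _ _) (min_le_right _ _) ht), hGc, ?_⟩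
  rw [hG0, hH0]
  exact circleIntegral_resolvent_add hmul hmul'
    (fun z hz => mem_resolventSet_cayley hc h1 hspec hz)
    (fun z hz => mem_resolventSet_cayley hc h2 hspec' hz)

end CayleySum

/-! ### Complexification of a real Banach space and of its operators. -/

section Complexification

variable (E : Type*) [NormedAddCommGroup E] [NormedSpace ℝ E]

/-- The complexification of a real normed space, as the space of real linear maps `ℂ → E`. -/
def Complexified : Type _ := ℂ →L[ℝ] E

noncomputable instance : NormedAddCommGroup (Complexified E) :=
  inferInstanceAs (NormedAddCommGroup (ℂ →L[ℝ] E))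

instance [CompleteSpace E] : CompleteSpace (Complexified E) :=
  inferInstanceAs (CompleteSpace (ℂ →L[ℝ] E))

noncomputable instance : FunLike (Complexified E) ℂ E := inferInstanceAs (FunLike (ℂ →L[ℝ] E) ℂ E)

instance : ContinuousLinearMapClass (Complexified E) ℝ ℂ E :=
  inferInstanceAs (ContinuousLinearMapClass (ℂ →L[ℝ] E) ℝ ℂ E)

variable {E}

namespace Complexified

@[ext] theorem ext {φ ψ : Complexified E} (h : ∀ w : ℂ, φ w = ψ w) : φ = ψ :=
  DFunLike.ext _ _ h

/-- Scalars act by precomposition with multiplication on `ℂ`, so the operator norm is a complex norm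
with no renorming. The real part of `φ` is then `φ 1`. -/
noncomputable instance : SMul ℂ (Complexified E) :=
  ⟨fun z φ => (ContinuousLinearMap.comp (φ : ℂ →L[ℝ] E) (ContinuousLinearMap.mul ℝ ℂ z) :
    ℂ →L[ℝ] E)⟩

theorem smul_apply (z : ℂ) (φ : Complexified E) (w : ℂ) : (z • φ) w = φ (z * w) := rfl

theorem add_apply (φ ψ : Complexified E) (w : ℂ) : (φ + ψ) w = φ w + ψ w := rfl

theorem zero_apply (w : ℂ) : (0 : Complexified E) w = 0 := rfl

theorem le_opNorm (φ : Complexified E) (w : ℂ) : ‖φ w‖ ≤ ‖φ‖ * ‖w‖ :=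
  ContinuousLinearMap.le_opNorm (φ : ℂ →L[ℝ] E) w

theorem opNorm_le_bound (φ : Complexified E) {C : ℝ} (hC : 0 ≤ C) (h : ∀ w, ‖φ w‖ ≤ C * ‖w‖) :
    ‖φ‖ ≤ C := ContinuousLinearMap.opNorm_le_bound (φ : ℂ →L[ℝ] E) hC h

noncomputable instance : NormedSpace ℂ (Complexified E) where
  one_smul φ := by ext w; simp [smul_apply]
  mul_smul z z' φ := by ext w; simp only [smul_apply]; congr 1; ring
  smul_zero z := by ext w; simp [smul_apply, zero_apply]
  smul_add z φ ψ := by ext w; simp [smul_apply, add_apply]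
  add_smul z z' φ := by ext w; simp [smul_apply, add_apply, add_mul]
  zero_smul φ := by ext w; simp [smul_apply, zero_apply]
  norm_smul_le z φ := by
    refine opNorm_le_bound _ (by positivity) fun w => ?_
    rw [smul_apply]
    refine (le_opNorm _ _).trans_eq ?_
    rw [norm_mul]
    ring

theorem real_smul_apply (r : ℝ) (φ : Complexified E) (w : ℂ) : (r • φ) w = r • φ w := by
  change φ ((r : ℂ) * w) = _
  rw [← Complex.real_smul, map_smul]

/-- The real inclusion into the complexification. -/
noncomputable def incl : E →L[ℝ] Complexified E :=
  LinearMap.mkContinuous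
    { toFun := fun x => (Complex.reCLM.smulRight x : ℂ →L[ℝ] E)
      map_add' := fun x y => by
        ext w
        exact smul_add w.re x y
      map_smul' := fun r x => by
        ext w
        refine Eq.trans ?_ (real_smul_apply r _ w).symm
        exact smul_comm w.re r x } 1 fun x => by
    refine opNorm_le_bound _ (by positivity) fun w => ?_
    change ‖w.re • x‖ ≤ _
    rw [norm_smul, one_mul, mul_comm]
    exact mul_le_mul_of_nonneg_left (Complex.abs_re_le_norm w) (norm_nonneg _)

theorem incl_apply (x : E) (w : ℂ) : incl x w = w.re • x := rfl

/-- Real part. -/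
noncomputable def realPart : Complexified E →L[ℝ] E :=
  LinearMap.mkContinuous
    { toFun := fun φ => φ 1
      map_add' := fun _ _ => rfl
      map_smul' := fun r φ => real_smul_apply r φ 1 } 1 fun φ => by
    have := le_opNorm φ 1
    rwa [norm_one, mul_comm] at this

/-- Extension of scalars for a bounded operator. -/
noncomputable def mapCLM (T : E →L[ℝ] E) : Complexified E →L[ℂ] Complexified E :=
  LinearMap.mkContinuous
    { toFun := fun φ => (T.comp (φ : ℂ →L[ℝ] E) : ℂ →L[ℝ] E)
      map_add' := fun φ ψ => by
        ext w
        exact map_add T (φ w) (ψ w)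
      map_smul' := fun _ _ => rfl } ‖T‖ fun φ => by
    exact ContinuousLinearMap.opNorm_comp_le T (φ : ℂ →L[ℝ] E)

theorem mapCLM_apply (T : E →L[ℝ] E) (φ : Complexified E) (w : ℂ) : mapCLM T φ w = T (φ w) := rfl

/-- Extension of scalars as an algebra homomorphism. -/
noncomputable def mapAlgHom :
    (E →L[ℝ] E) →ₐ[ℝ] (Complexified E →L[ℂ] Complexified E) where
  toFun := mapCLM
  map_one' := rfl
  map_mul' _ _ := rfl
  map_zero' := rfl
  map_add' _ _ := rfl
  commutes' r := by
    ext φ w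
    exact (real_smul_apply r φ w).symm

/-- The real part of an operator of the complexification. -/
noncomputable def realPartCLM :
    (Complexified E →L[ℂ] Complexified E) →L[ℝ] (E →L[ℝ] E) :=
  LinearMap.mkContinuous
    { toFun := fun X => realPart.comp ((X.restrictScalars ℝ).comp incl)
      map_add' := fun _ _ => rfl
      map_smul' := fun r X => by
        ext x
        exact real_smul_apply r (X (incl x)) 1 } (‖(realPart : Complexified E →L[ℝ] E)‖ *
          ‖(incl : E →L[ℝ] Complexified E)‖) fun X => by
    refine (ContinuousLinearMap.opNorm_comp_le _ _).trans ?_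
    rw [mul_assoc]
    refine mul_le_mul_of_nonneg_left ?_ (norm_nonneg _)
    refine (ContinuousLinearMap.opNorm_comp_le _ _).trans_eq ?_
    rw [ContinuousLinearMap.norm_restrictScalars, mul_comm]

/-- Taking real parts respects left and, by the next lemma, right multiplication by real operators,
so differential equations and commutation relations descend to `E`. It is not multiplicative in
general, so idempotency must be obtained otherwise, in `mul_self_eq_of_exp_decay`. -/
theorem realPartCLM_map_mul (T : E →L[ℝ] E) (X : Complexified E →L[ℂ] Complexified E) :
    realPartCLM (mapAlgHom T * X) = T * realPartCLM X := rfl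

theorem realPartCLM_mul_map (T : E →L[ℝ] E) (X : Complexified E →L[ℂ] Complexified E) :
    realPartCLM (X * mapAlgHom T) = realPartCLM X * T := by
  ext x
  have : mapCLM T (incl x) = incl (T x) := by
    ext w
    rw [mapCLM_apply, incl_apply, incl_apply, map_smul]
  change X (mapCLM T (incl x)) 1 = X (incl (T x)) 1
  rw [this]

theorem realPartCLM_one : realPartCLM (1 : Complexified E →L[ℂ] Complexified E) = 1 := by
  ext x
  change (1 : ℂ).re • x = x
  simp

/-- Algebra homomorphisms do not enlarge spectra, and this inclusion suffices to keep the spectrum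
off the imaginary axis. -/
theorem spectrum_map_subset (T : E →L[ℝ] E) :
    spectrum ℂ (mapAlgHom T) ⊆ complexSpectrum T := by
  let φ : ℂ ⊗[ℝ] (E →L[ℝ] E) →ₐ[ℂ] (Complexified E →L[ℂ] Complexified E) :=
    Algebra.TensorProduct.lift (Algebra.ofId ℂ _) mapAlgHom
      fun z T => Algebra.commutes z (mapAlgHom T)
  have h : φ (1 ⊗ₜ[ℝ] T) = mapAlgHom T := by
    refine (Algebra.TensorProduct.lift_tmul _ _ _ _ _).trans ?_
    rw [map_one, one_mul]
  rw [← h]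
  exact AlgHom.spectrum_apply_subset φ _

end Complexified

end Complexification

/-! ### Idempotency from exponential decay. -/

section ExpDichotomy

variable {R : Type*} [NormedRing R] [NormedAlgebra ℝ R]

theorem commute_exp_smul {a p : R} (h : Commute a p) (t : ℝ) :
    Commute (NormedSpace.exp (t • a)) p := (h.smul_left t).exp_left

variable [CompleteSpace R]

theorem exp_add_smul (a : R) (s t : ℝ) :
    NormedSpace.exp ((s + t) • a) = NormedSpace.exp (s • a) * NormedSpace.exp (t • a) := by
  let _ : NormedAlgebra ℚ R := NormedAlgebra.restrictScalars ℚ ℝ R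
  rw [add_smul]
  exact NormedSpace.exp_add_of_commute (((Commute.refl a).smul_left s).smul_right t)

theorem exp_neg_smul_mul (a : R) (t : ℝ) :
    NormedSpace.exp (-t • a) * NormedSpace.exp (t • a) = 1 := by
  rw [← exp_add_smul]
  simp

theorem eq_exp_mul_of_hasDerivAt {a : R} {X : ℝ → R} (hX : ∀ t, HasDerivAt X (a * X t) t) (t : ℝ) :
    X t = NormedSpace.exp (t • a) * X 0 := by
  have key : X = fun t => NormedSpace.exp (t • a) * X 0 := by
    refine ODE_solution_unique_univ (v := fun _ x => a * x) (s := fun _ => univ)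
      (K := ‖a‖₊) (t₀ := 0)
      (fun t => (lipschitzWith_mul_left_of_norm_le le_rfl).lipschitzOnWith)
      (fun t => ⟨hX t, trivial⟩) (fun t => ⟨?_, trivial⟩) (by simp)
    have := (hasDerivAt_exp_smul_const' (𝕂 := ℝ) a t).mul_const (X 0)
    rwa [mul_assoc] at this
  exact congrFun key t

/-- Complementary operators with exponential decay along the two halves of the group `exp (t a)`
are projections. -/
theorem mul_self_eq_of_exp_decay {a p : R} {C δ : ℝ} (hδ : 0 < δ) (hc : Commute a p)
    (h₁ : ∀ t : ℝ, 0 ≤ t → ‖NormedSpace.exp (t • a) * p‖ ≤ C * Real.exp (-δ * t))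
    (h₂ : ∀ t : ℝ, 0 ≤ t → ‖NormedSpace.exp (-t • a) * (1 - p)‖ ≤ C * Real.exp (-δ * t)) :
    p * p = p := by
  have hcq : Commute a (1 - p) := (Commute.one_right a).sub_right hc
  have hC : 0 ≤ C := by simpa using (norm_nonneg _).trans (h₁ 0 le_rfl)
  have hpq : Commute p (1 - p) := (Commute.one_right p).sub_right (Commute.refl p)
  -- Both `exp (t a) y` and `exp (-t a) y` stay bounded for `t ≥ 0`. Inserting `exp (t a) exp (-t
  -- a)` writes `p y` and `(1 - p) y` as a decaying factor times a bounded one, so both vanish and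
  -- `y = 0`.
  set y := p * (1 - p) with hy
  have hle : ∀ t : ℝ, 0 ≤ t → C * Real.exp (-δ * t) ≤ C := fun t ht =>
    mul_le_of_le_one_right hC (Real.exp_le_one_iff.2 (by nlinarith))
  have b₁ : ∀ t : ℝ, 0 ≤ t → ‖NormedSpace.exp (t • a) * y‖ ≤ C * ‖1 - p‖ := fun t ht => by
    rw [hy, ← mul_assoc]
    exact (norm_mul_le _ _).trans
      (mul_le_mul_of_nonneg_right ((h₁ t ht).trans (hle t ht)) (norm_nonneg _))
  have b₂ : ∀ t : ℝ, 0 ≤ t → ‖NormedSpace.exp (-t • a) * y‖ ≤ C * ‖p‖ := fun t ht => by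
    rw [hy, hpq.eq, ← mul_assoc]
    exact (norm_mul_le _ _).trans
      (mul_le_mul_of_nonneg_right ((h₂ t ht).trans (hle t ht)) (norm_nonneg _))
  have hlim : ∀ D : ℝ, Tendsto (fun s => C * Real.exp (-δ * s) * D) atTop (𝓝 0) := fun D => by
    have : Tendsto (fun s => Real.exp (-δ * s)) atTop (𝓝 0) :=
      Real.tendsto_exp_atBot.comp (tendsto_id.const_mul_atTop_of_neg (neg_lt_zero.2 hδ))
    simpa using (this.const_mul C).mul_const D
  have z₁ : p * y = 0 := by
    refine norm_le_zero_iff.1 (ge_of_tendsto (hlim (C * ‖p‖)) ?_)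
    filter_upwards [eventually_ge_atTop 0] with t ht
    have e : p * y = (NormedSpace.exp (t • a) * p) * (NormedSpace.exp (-t • a) * y) := by
      have := exp_neg_smul_mul a (-t)
      rw [neg_neg] at this
      rw [(commute_exp_smul hc t).eq, mul_assoc, ← mul_assoc (NormedSpace.exp _), this, one_mul]
    rw [e]
    exact (norm_mul_le _ _).trans (mul_le_mul (h₁ t ht) (b₂ t ht) (norm_nonneg _) (by positivity))
  have z₂ : (1 - p) * y = 0 := by
    refine norm_le_zero_iff.1 (ge_of_tendsto (hlim (C * ‖1 - p‖)) ?_)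
    filter_upwards [eventually_ge_atTop 0] with t ht
    have e : (1 - p) * y =
        (NormedSpace.exp (-t • a) * (1 - p)) * (NormedSpace.exp (t • a) * y) := by
      rw [(commute_exp_smul hcq (-t)).eq, mul_assoc, ← mul_assoc (NormedSpace.exp _),
        exp_neg_smul_mul, one_mul]
    rw [e]
    exact (norm_mul_le _ _).trans (mul_le_mul (h₂ t ht) (b₁ t ht) (norm_nonneg _) (by positivity))
  have hy0 : y = 0 := by
    rw [sub_mul, one_mul, z₁, sub_zero] at z₂
    exact z₂
  rw [hy, mul_sub, mul_one, sub_eq_zero] at hy0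
  exact hy0.symm

end ExpDichotomy

/-! ### Exponential dichotomy of a constant real operator. -/

section ConstantCoefficients

variable {E : Type*} [NormedAddCommGroup E] [NormedSpace ℝ E] [CompleteSpace E]

/-- Exponential dichotomy of `exp (t A)` when the complex spectrum of `A` does not meet the
imaginary axis. -/
theorem exists_exponential_dichotomy {A : E →L[ℝ] E}
    (hspec : ∀ z ∈ complexSpectrum A, z.re ≠ 0) :
    ∃ (P : E →L[ℝ] E) (N ν : ℝ), 0 < N ∧ 0 < ν ∧ P * P = P ∧ Commute A P ∧
      (∀ t : ℝ, 0 ≤ t → ‖NormedSpace.exp (t • A) * P‖ ≤ N * Real.exp (-ν * t)) ∧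
      ∀ t : ℝ, 0 ≤ t → ‖NormedSpace.exp (-t • A) * (1 - P)‖ ≤ N * Real.exp (-ν * t) := by
  obtain ⟨G, H, C, δ, hC, hδ, hG, hH, hGb, hHb, hGc, hsum⟩ :=
    exists_exponential_splitting (a := Complexified.mapAlgHom A)
      fun z hz => hspec z (Complexified.spectrum_map_subset A hz)
  let ρ := Complexified.realPartCLM (E := E)
  have hρ : ∀ X, ‖ρ X‖ ≤ ‖ρ‖ * ‖X‖ := ρ.le_opNorm
  have dG : ∀ t, HasDerivAt (fun t => ρ (G t)) (A * ρ (G t)) t := fun t =>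
    ρ.hasFDerivAt.comp_hasDerivAt t (hG t)
  have dH : ∀ t, HasDerivAt (fun t => ρ (H t)) (-A * ρ (H t)) t := fun t => by
    have := ρ.hasFDerivAt.comp_hasDerivAt t (hH t)
    rw [← map_neg] at this
    exact this
  have hQ : ρ (H 0) = 1 - ρ (G 0) := by
    rw [eq_sub_iff_add_eq', ← map_add, hsum]
    exact Complexified.realPartCLM_one
  have hcomm : Commute A (ρ (G 0)) := by
    have := congrArg ρ hGc.eq
    exact (Complexified.realPartCLM_map_mul A (G 0)).symm.trans
      (this.trans (Complexified.realPartCLM_mul_map A (G 0)))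
  have h₁ : ∀ t : ℝ, 0 ≤ t → ‖NormedSpace.exp (t • A) * ρ (G 0)‖ ≤
      (‖ρ‖ * C + 1) * Real.exp (-δ * t) := fun t ht => by
    rw [← eq_exp_mul_of_hasDerivAt dG]
    refine (hρ _).trans ((mul_le_mul_of_nonneg_left (hGb t ht) (norm_nonneg ρ)).trans ?_)
    nlinarith [Real.exp_nonneg (-δ * t)]
  have h₂ : ∀ t : ℝ, 0 ≤ t → ‖NormedSpace.exp (-t • A) * (1 - ρ (G 0))‖ ≤
      (‖ρ‖ * C + 1) * Real.exp (-δ * t) := fun t ht => by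
    have := eq_exp_mul_of_hasDerivAt dH t
    rw [smul_neg, ← neg_smul, hQ] at this
    rw [← this]
    refine (hρ _).trans ((mul_le_mul_of_nonneg_left (hHb t ht) (norm_nonneg ρ)).trans ?_)
    nlinarith [Real.exp_nonneg (-δ * t)]
  exact ⟨ρ (G 0), ‖ρ‖ * C + 1, δ, by positivity, hδ, mul_self_eq_of_exp_decay hδ hcomm h₁ h₂,
    hcomm, h₁, h₂⟩

variable {Ω : Type*} [TopologicalSpace Ω]

theorem isCauchyOperator_exp (σ : Flow ℝ Ω) (A : E →L[ℝ] E) :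
    IsCauchyOperator σ (ContinuousMap.const Ω A) fun t _ => NormedSpace.exp (t • A) :=
  fun _ => ⟨by simp, fun t => hasDerivAt_exp_smul_const' (𝕂 := ℝ) A t⟩

theorem inverse_exp_smul (A : E →L[ℝ] E) (t : ℝ) :
    Ring.inverse (NormedSpace.exp (t • A)) = NormedSpace.exp (-t • A) := by
  have h := exp_neg_smul_mul A (-t)
  rw [neg_neg] at h
  exact Ring.inverse_unit ⟨NormedSpace.exp (t • A), NormedSpace.exp (-t • A), h,
    exp_neg_smul_mul A t⟩

/-- Replacing `A` by `ε A` only rescales time: `N` and `P` persist and the rate becomes `ε ν`. -/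
theorem isHyperbolic_exp (σ : Flow ℝ Ω) {A P : E →L[ℝ] E} {N ν ε : ℝ} (hN : 0 < N) (hν : 0 < ν)
    (hε : 0 < ε) (hP : P * P = P) (hc : Commute A P)
    (h₁ : ∀ t : ℝ, 0 ≤ t → ‖NormedSpace.exp (t • A) * P‖ ≤ N * Real.exp (-ν * t))
    (h₂ : ∀ t : ℝ, 0 ≤ t → ‖NormedSpace.exp (-t • A) * (1 - P)‖ ≤ N * Real.exp (-ν * t)) :
    IsHyperbolic σ (fun t _ => NormedSpace.exp (t • ε • A)) (ContinuousMap.const Ω P) N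
      (ε * ν) where
  N_pos := hN
  nu_pos := mul_pos hε hν
  proj _ := hP
  comm t _ := by
    simp only [ContinuousMap.const_apply, smul_smul]
    exact (commute_exp_smul hc _).eq
  stable _ t τ h := by
    simp only [ContinuousMap.const_apply]
    rw [inverse_exp_smul, smul_smul, smul_smul, (commute_exp_smul hc _).eq, mul_assoc,
      ← exp_add_smul, ← (commute_exp_smul hc _).eq]
    have := h₁ ((t - τ) * ε) (mul_nonneg (sub_nonneg.2 h) hε.le)
    convert this using 2
    · congr 3
      ring
    · congr 1
      ring
  unstable _ t τ h := by
    have hc' : Commute A (1 - P) := (Commute.one_right A).sub_right hc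
    simp only [ContinuousMap.const_apply]
    rw [inverse_exp_smul, smul_smul, smul_smul, (commute_exp_smul hc' _).eq, mul_assoc,
      ← exp_add_smul, ← (commute_exp_smul hc' _).eq]
    have := h₂ ((τ - t) * ε) (mul_nonneg (sub_nonneg.2 h) hε.le)
    convert this using 2
    · congr 3
      ring
    · congr 1
      ring

end ConstantCoefficients

/-! ### Time averages along the flow. -/

section TimeAverage

variable {Ω V : Type*} [MetricSpace Ω] [NormedAddCommGroup V] [NormedSpace ℝ V]

/-- The time average of a continuous function along a flow, over a window of length `T`. -/
noncomputable def timeAverage (σ : Flow ℝ Ω) (T : ℝ) (φ : C(Ω, V)) : C(Ω, V) where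
  toFun ω := T⁻¹ • ∫ t in (0 : ℝ)..T, φ (σ t ω)
  continuous_toFun := by
    refine (intervalIntegral.continuous_parametric_intervalIntegral_of_continuous'
      (f := fun ω t => φ (σ t ω)) ?_ 0 T).const_smul _
    have := φ.continuous
    simp only [Function.uncurry_def]
    fun_prop

theorem timeAverage_apply (σ : Flow ℝ Ω) (T : ℝ) (φ : C(Ω, V)) (ω : Ω) :
    timeAverage σ T φ ω = T⁻¹ • ∫ t in (0 : ℝ)..T, φ (σ t ω) := rfl

theorem continuous_comp_flow {W : Type*} [TopologicalSpace W] (σ : Flow ℝ Ω) (φ : C(Ω, W))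
    (ω : Ω) :
    Continuous fun t => φ (σ t ω) :=
  φ.continuous.comp (by fun_prop)

theorem norm_inv_smul_integral_sub_le {T C : ℝ} (hT : 0 < T) {g h : ℝ → V} (hg : Continuous g)
    (hh : Continuous h) (hC : ∀ t ∈ Icc 0 T, ‖g t - h t‖ ≤ C) :
    ‖T⁻¹ • (∫ t in (0 : ℝ)..T, g t) - T⁻¹ • ∫ t in (0 : ℝ)..T, h t‖ ≤ C := by
  rw [← smul_sub, ← intervalIntegral.integral_sub (hg.intervalIntegrable _ _)
    (hh.intervalIntegrable _ _), norm_smul, norm_inv, Real.norm_of_nonneg hT.le,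
    inv_mul_le_iff₀ hT]
  refine (intervalIntegral.norm_integral_le_of_norm_le_const fun t ht => hC t ?_).trans_eq ?_
  · rw [uIoc_of_le hT.le] at ht
    exact ⟨ht.1.le, ht.2⟩
  · rw [sub_zero, abs_of_pos hT, mul_comm]

theorem inv_smul_integral_const {T : ℝ} (hT : 0 < T) (x : V) [CompleteSpace V] :
    T⁻¹ • (∫ _t in (0 : ℝ)..T, x) = x := by
  rw [intervalIntegral.integral_const, sub_zero, smul_smul, inv_mul_cancel₀ hT.ne', one_smul]

end TimeAverage

/-! ### The slow equation `w' = ε (A w + h)` with oscillating forcing. -/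

section GreenOperator

variable {Ω E : Type*} [MetricSpace Ω] [CompactSpace Ω]
  [NormedAddCommGroup E] [NormedSpace ℝ E]

/-- `S` solves the equation `w' = ε (A w + h)` along the flow, uniquely and with bound `K`. -/
structure IsGreenOperator (σ : Flow ℝ Ω) (A : E →L[ℝ] E) (ε K : ℝ)
    (S : C(Ω, E) → C(Ω, E)) : Prop where
  norm_le : ∀ h, ‖S h‖ ≤ K * ‖h‖
  hasDerivAt : ∀ h ω t, HasDerivAt (fun t => S h (σ t ω))
    (ε • (A (S h (σ t ω)) + h (σ t ω))) t
  unique : ∀ h w : C(Ω, E), (∀ ω t, HasDerivAt (fun t => w (σ t ω))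
    (ε • (A (w (σ t ω)) + h (σ t ω))) t) → S h = w

/-- The factor `ε` in the forcing cancels the `ε` in the bound `2N/(εν)`, so one `K` works for all
`ε`. -/
theorem exists_isGreenOperator [CompleteSpace E] {A : E →L[ℝ] E}
    (hspec : ∀ z ∈ complexSpectrum A, z.re ≠ 0) :
    ∃ K : ℝ, 0 < K ∧ ∀ (σ : Flow ℝ Ω) (ε : ℝ), 0 < ε →
      ∃ S : C(Ω, E) → C(Ω, E), IsGreenOperator σ A ε K S := by
  obtain ⟨P, N, ν, hN, hν, hP, hc, h₁, h₂⟩ := exists_exponential_dichotomy hspec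
  refine ⟨2 * N / ν, by positivity, fun σ ε hε => ?_⟩
  have hU := isCauchyOperator_exp σ (ε • A)
  have hH := isHyperbolic_exp σ hN hν hε hP hc h₁ h₂
  refine ⟨fun h => hH.greenMap hU (ε • h), fun h => ?_, fun h ω t => ?_, fun h w hw => ?_⟩
  · refine (hH.norm_greenMap_le hU _).trans_eq ?_
    rw [norm_smul, Real.norm_of_nonneg hε.le]
    field_simp
  · have := hH.hasDerivAt_greenSection hU (ε • h) ω t
    rw [smul_add]
    exact this
  · refine hH.greenMap_unique hU fun ω t => ?_
    have := hw ω t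
    rw [smul_add] at this
    exact this

namespace IsGreenOperator

variable {σ : Flow ℝ Ω} {A : E →L[ℝ] E} {ε K : ℝ} {S : C(Ω, E) → C(Ω, E)}

theorem map_sub (hS : IsGreenOperator σ A ε K S) (h₁ h₂ : C(Ω, E)) :
    S (h₁ - h₂) = S h₁ - S h₂ := by
  refine hS.unique _ _ fun ω t => ?_
  have := (hS.hasDerivAt h₁ ω t).sub (hS.hasDerivAt h₂ ω t)
  rw [← smul_sub, add_sub_add_comm, ← _root_.map_sub] at this
  exact this

theorem map_zero (hS : IsGreenOperator σ A ε K S) : S 0 = 0 := by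
  simpa using hS.map_sub 0 0

theorem map_add (hS : IsGreenOperator σ A ε K S) (h₁ h₂ : C(Ω, E)) :
    S (h₁ + h₂) = S h₁ + S h₂ := by
  have := hS.map_sub (h₁ + h₂) h₂
  rw [add_sub_cancel_right] at this
  rw [this, sub_add_cancel]

theorem continuous (hS : IsGreenOperator σ A ε K S) (hK : 0 ≤ K) : Continuous S := by
  refine LipschitzWith.continuous (K := ⟨K, hK⟩) (LipschitzWith.of_dist_le_mul fun h₁ h₂ => ?_)
  rw [dist_eq_norm, dist_eq_norm, ← hS.map_sub]
  exact hS.norm_le _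

theorem norm_flow_sub_le (hS : IsGreenOperator σ A ε K S) (hε : 0 ≤ ε) (h : C(Ω, E)) (ω : Ω)
    {t : ℝ} (ht : 0 ≤ t) : ‖S h (σ t ω) - S h ω‖ ≤ ε * t * ((‖A‖ * K + 1) * ‖h‖) := by
  have h1 := convex_univ.norm_image_sub_le_of_norm_hasDerivWithin_le
    (f := fun t => S h (σ t ω)) (x := 0) (y := t) (C := ε * ((‖A‖ * K + 1) * ‖h‖))
    (fun t _ => (hS.hasDerivAt h ω t).hasDerivWithinAt) (fun t _ => ?_) trivial trivial
  · simp only [σ.map_zero_apply, sub_zero, Real.norm_of_nonneg ht] at h1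
    refine h1.trans_eq ?_
    ring
  · rw [norm_smul, Real.norm_of_nonneg hε]
    refine mul_le_mul_of_nonneg_left ((norm_add_le _ _).trans ?_) hε
    have h2 : ‖A (S h (σ t ω))‖ ≤ ‖A‖ * (K * ‖h‖) :=
      A.le_opNorm_of_le (((S h).norm_coe_le_norm _).trans (hS.norm_le h))
    linarith [h.norm_coe_le_norm (σ t ω)]

variable [CompleteSpace E]

/-- The averaged solution solves the averaged equation, and uniqueness applies. -/
theorem map_timeAverage (hS : IsGreenOperator σ A ε K S) (T : ℝ) (h : C(Ω, E)) :
    S (timeAverage σ T h) = timeAverage σ T (S h) := by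
  refine hS.unique _ _ fun ω t => ?_
  have hcS := continuous_comp_flow σ (S h)
  have hch := continuous_comp_flow σ h
  have h1 : HasDerivAt (fun t => ∫ s in (0 : ℝ)..T, S h (σ s (σ t ω)))
      (∫ s in (0 : ℝ)..T, ε • (A (S h (σ s (σ t ω))) + h (σ s (σ t ω)))) t := by
    refine hasDerivAt_intervalIntegral_of_continuous
      (F := fun t s => S h (σ s (σ t ω)))
      (F' := fun t s => ε • (A (S h (σ s (σ t ω))) + h (σ s (σ t ω))))
      (fun t => hcS _) ?_ (fun t s => ?_) 0 T t
    · have e1 := (S h).continuous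
      have e2 := h.continuous
      simp only [Function.uncurry_def]
      fun_prop
    · have e := (hS.hasDerivAt h ω (s + t)).comp_const_add s t
      simpa only [σ.map_add] using e
  have hcA : Continuous fun s => A (S h (σ s (σ t ω))) := A.continuous.comp (hcS _)
  have h2 := h1.const_smul T⁻¹
  rw [intervalIntegral.integral_smul, intervalIntegral.integral_add
    (hcA.intervalIntegrable _ _) ((hch _).intervalIntegrable _ _),
    smul_comm, smul_add, ContinuousLinearMap.intervalIntegral_comp_comm _
      ((hcS _).intervalIntegrable _ _), ← map_smul] at h2
  exact h2

/-- `S h` changes by `O(ε T)` over a window of length `T`, so it is close to its own average, which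
is `S` of the average of `h`. -/
theorem norm_le_of_timeAverage (hS : IsGreenOperator σ A ε K S) (hε : 0 ≤ ε) {T : ℝ}
    (hT : 0 < T) (h : C(Ω, E)) :
    ‖S h‖ ≤ ε * T * ((‖A‖ * K + 1) * ‖h‖) + K * ‖timeAverage σ T h‖ := by
  have hK : 0 ≤ K * ‖h‖ := (norm_nonneg _).trans (hS.norm_le h)
  have h0 : 0 ≤ (‖A‖ * K + 1) * ‖h‖ := by
    have := mul_nonneg (norm_nonneg A) hK
    linarith [norm_nonneg h]
  have h1 : ‖S h - timeAverage σ T (S h)‖ ≤ ε * T * ((‖A‖ * K + 1) * ‖h‖) := by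
    refine (ContinuousMap.norm_le _ (by positivity)).2 fun ω => ?_
    have h2 := norm_inv_smul_integral_sub_le (C := ε * T * ((‖A‖ * K + 1) * ‖h‖)) hT
      (continuous_const (y := S h ω)) (continuous_comp_flow σ (S h) ω) fun t ht => by
        rw [norm_sub_rev]
        refine (hS.norm_flow_sub_le hε h ω ht.1).trans ?_
        gcongr
        exact ht.2
    rwa [inv_smul_integral_const hT] at h2
  have h3 : ‖timeAverage σ T (S h)‖ ≤ K * ‖timeAverage σ T h‖ := by
    rw [← hS.map_timeAverage]
    exact hS.norm_le _
  have h4 : ‖S h‖ ≤ ‖S h - timeAverage σ T (S h)‖ + ‖timeAverage σ T (S h)‖ := by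
    simpa using norm_add_le (S h - timeAverage σ T (S h)) (timeAverage σ T (S h))
  linarith

/-- Averaging of an oscillating linear multiplier applied to a slowly varying function. -/
theorem norm_mul_le (hS : IsGreenOperator σ A ε K S) (hε : 0 ≤ ε) (hK : 0 ≤ K) {T δ : ℝ}
    (hT : 0 < T) (b : C(Ω, E →L[ℝ] E)) (hb : ∀ ω, ‖timeAverage σ T b ω‖ ≤ δ) (k φ : C(Ω, E))
    (hφ : ∀ ω, φ ω = b ω (S k ω)) :
    ‖S φ‖ ≤ K * δ * ‖S k‖ + 2 * (ε * T * (‖A‖ * K + 1)) * (K * ‖b‖) * ‖k‖ := by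
  have h1 : ‖φ‖ ≤ ‖b‖ * (K * ‖k‖) := (ContinuousMap.norm_le _ (by positivity)).2 fun ω => by
    rw [hφ]
    exact (b ω).le_of_opNorm_le_of_le (b.norm_coe_le_norm ω)
      (((S k).norm_coe_le_norm ω).trans (hS.norm_le k))
  -- Nonnegativity of `δ` is read off at a point of `Ω`, so the empty case is settled separately.
  rcases isEmpty_or_nonempty Ω with hΩ | ⟨⟨ω₀⟩⟩
  · have : S φ = 0 := ContinuousMap.ext fun ω => hΩ.elim ω
    have h2 : S k = 0 := ContinuousMap.ext fun ω => hΩ.elim ω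
    rw [this, h2, norm_zero, mul_zero, zero_add]
    positivity
  have hδ : 0 ≤ δ := (norm_nonneg _).trans (hb ω₀)
  -- Freeze the slow factor `S k` at the start of the window: the freezing error is `O(ε T)`, and
  -- what is left is the average of `b` applied to a constant vector.
  have h2 : ‖timeAverage σ T φ‖ ≤ ‖b‖ * (ε * T * ((‖A‖ * K + 1) * ‖k‖)) + δ * ‖S k‖ := by
    refine (ContinuousMap.norm_le _ (by positivity)).2 fun ω => ?_
    have hcb := continuous_comp_flow σ b ω
    have h3 := norm_inv_smul_integral_sub_le (C := ‖b‖ * (ε * T * ((‖A‖ * K + 1) * ‖k‖))) hT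
      (continuous_comp_flow σ φ ω) (h := fun t => b (σ t ω) (S k ω))
      (hcb.clm_apply continuous_const) fun t ht => by
        rw [hφ, ← _root_.map_sub]
        refine (b _).le_of_opNorm_le_of_le (b.norm_coe_le_norm _)
          ((hS.norm_flow_sub_le hε k ω ht.1).trans ?_)
        gcongr
        exact ht.2
    have h4 : T⁻¹ • (∫ t in (0 : ℝ)..T, b (σ t ω) (S k ω)) = timeAverage σ T b ω (S k ω) := by
      rw [timeAverage_apply, smul_apply,
        ContinuousLinearMap.intervalIntegral_apply (hcb.intervalIntegrable _ _)]
    rw [h4] at h3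
    have h5 : ‖timeAverage σ T b ω (S k ω)‖ ≤ δ * ‖S k‖ :=
      ContinuousLinearMap.le_of_opNorm_le_of_le _ (hb ω) ((S k).norm_coe_le_norm ω)
    have h6 := norm_add_le (timeAverage σ T φ ω - timeAverage σ T b ω (S k ω))
      (timeAverage σ T b ω (S k ω))
    rw [sub_add_cancel] at h6
    exact h6.trans (add_le_add h3 h5)
  refine (hS.norm_le_of_timeAverage hε hT φ).trans ?_
  have h7 : ε * T * ((‖A‖ * K + 1) * ‖φ‖) ≤
      ε * T * ((‖A‖ * K + 1) * (‖b‖ * (K * ‖k‖))) := by gcongr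
  have h8 := mul_le_mul_of_nonneg_left h2 hK
  refine (add_le_add h7 h8).trans_eq ?_
  ring

/-- Fixed point theorem for `k = f (·, S k) - A (S k)` with an oscillating nonlinearity, given as
an operator `M` with linear part `b + A`. -/
theorem exists_fixedPoint (hS : IsGreenOperator σ A ε K S) (hε : 0 ≤ ε) (hK : 0 ≤ K)
    {T δ δ' θ ρ m η : ℝ} (hT : 0 < T) (hρ : 0 ≤ ρ) (hθ : 0 ≤ θ)
    (b : C(Ω, E →L[ℝ] E)) (hb : ∀ ω, ‖timeAverage σ T b ω‖ ≤ δ) (M : C(Ω, E) → C(Ω, E))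
    (hM : ∀ v w : C(Ω, E), ‖v‖ ≤ ρ → ‖w‖ ≤ ρ → ∀ ω,
      ‖M v ω - M w ω - (b ω + A) (v ω - w ω)‖ ≤ θ * ‖v - w‖)
    (hM0 : ∀ ω, ‖timeAverage σ T (M 0) ω‖ ≤ δ') (hδ' : 0 ≤ δ') (hδ : 0 ≤ δ)
    (hm : ‖M 0‖ + (θ + ‖b‖) * ρ ≤ m) (hη : ε * T * (‖A‖ * K + 1) = η)
    (h₁ : K * δ' + η * ‖M 0‖ + K * θ * ρ + K * δ * ρ + 2 * η * (K * ‖b‖) * m ≤ ρ)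
    (h₂ : (θ + ‖b‖) * (K * θ * K + K * δ * K + 2 * η * (K * ‖b‖)) ≤ 1 / 2) :
    ∃ k : C(Ω, E), ‖S k‖ ≤ ρ ∧ ∀ ω, k ω + A (S k ω) = M (S k) ω := by
  have hη0 : 0 ≤ η := hη ▸ by positivity
  have hm0 : 0 ≤ m := le_trans (by positivity) hm
  -- A fixed point `k` satisfies `A (S k) + k = M (S k)`, so `w = S k` solves `w' = ε M w` along the
  -- flow.
  let Ψ : C(Ω, E) → C(Ω, E) := fun k =>
    ⟨fun ω => M (S k) ω - A (S k ω), by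
      have e1 := (M (S k)).continuous
      have e2 := (S k).continuous
      fun_prop⟩
  have hΨ : ∀ k ω, Ψ k ω = M (S k) ω - A (S k ω) := fun _ _ => rfl
  have hΨ0 : Ψ 0 = M 0 := by
    ext ω
    rw [hΨ, hS.map_zero]
    simp
  let rem : C(Ω, E) → C(Ω, E) → C(Ω, E) := fun k l =>
    ⟨fun ω => M (S k) ω - M (S l) ω - (b ω + A) (S k ω - S l ω), by
      have e1 := (M (S k)).continuous
      have e2 := (S k).continuous
      have e3 := (M (S l)).continuous
      have e4 := (S l).continuous
      have e5 := b.continuous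
      fun_prop⟩
  let lin : C(Ω, E) → C(Ω, E) → C(Ω, E) := fun k l =>
    ⟨fun ω => b ω (S (k - l) ω), by
      have e1 := (S (k - l)).continuous
      have e2 := b.continuous
      fun_prop⟩
  have hdecomp : ∀ k l, Ψ k - Ψ l = rem k l + lin k l := fun k l => by
    ext ω
    have e : (rem k l + lin k l) ω =
      M (S k) ω - M (S l) ω - (b ω + A) (S k ω - S l ω) + b ω (S (k - l) ω) := rfl
    rw [e, hS.map_sub]
    simp only [ContinuousMap.sub_apply, hΨ, _root_.map_sub, add_apply]
    abel
  have hrem : ∀ k l, ‖S k‖ ≤ ρ → ‖S l‖ ≤ ρ → ‖rem k l‖ ≤ θ * ‖S (k - l)‖ := fun k l hk hl => by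
    rw [hS.map_sub]
    exact (ContinuousMap.norm_le _ (by positivity)).2 (hM _ _ hk hl)
  have hlin : ∀ k l, ‖lin k l‖ ≤ ‖b‖ * ‖S (k - l)‖ := fun k l =>
    (ContinuousMap.norm_le _ (by positivity)).2 fun ω =>
      (b ω).le_of_opNorm_le_of_le (b.norm_coe_le_norm ω) ((S (k - l)).norm_coe_le_norm ω)
  have hdiff : ∀ k l, ‖S k‖ ≤ ρ → ‖S l‖ ≤ ρ → ‖Ψ k - Ψ l‖ ≤ (θ + ‖b‖) * ‖S (k - l)‖ :=
    fun k l hk hl => by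
      rw [hdecomp, add_mul]
      exact (norm_add_le _ _).trans (add_le_add (hrem k l hk hl) (hlin k l))
  have hSdiff : ∀ k l, ‖S k‖ ≤ ρ → ‖S l‖ ≤ ρ → ‖S (Ψ k - Ψ l)‖ ≤
      K * θ * ‖S (k - l)‖ + K * δ * ‖S (k - l)‖ + 2 * η * (K * ‖b‖) * ‖k - l‖ :=
    fun k l hk hl => by
      rw [hdecomp, hS.map_add]
      have e1 := hS.norm_le (rem k l)
      have e2 := mul_le_mul_of_nonneg_left (hrem k l hk hl) hK
      have e3 := hS.norm_mul_le hε hK hT b hb (k - l) (lin k l) fun _ => rfl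
      rw [hη] at e3
      have e4 := norm_add_le (S (rem k l)) (S (lin k l))
      linarith
  -- Only `S k` has to be small; `k` itself oscillates with size of order `‖M 0‖` and is merely
  -- bounded by `m`.
  let X : Set C(Ω, E) := {k | ‖S k‖ ≤ ρ ∧ ‖k‖ ≤ m}
  have hX : IsClosed X :=
    (isClosed_le (hS.continuous hK).norm continuous_const).inter
      (isClosed_le continuous_norm continuous_const)
  have h0X : (0 : C(Ω, E)) ∈ X := ⟨by rwa [hS.map_zero, norm_zero], by rwa [norm_zero]⟩
  have hmaps : MapsTo Ψ X X := by
    intro k hk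
    have hd := hdiff k 0 hk.1 h0X.1
    have hSd := hSdiff k 0 hk.1 h0X.1
    rw [sub_zero, hΨ0] at hd hSd
    have e1 : ‖Ψ k‖ ≤ ‖Ψ k - M 0‖ + ‖M 0‖ := by simpa using norm_add_le (Ψ k - M 0) (M 0)
    have e2 : ‖S (Ψ k)‖ ≤ ‖S (Ψ k - M 0)‖ + ‖S (M 0)‖ := by
      rw [hS.map_sub]
      simpa using norm_add_le (S (Ψ k) - S (M 0)) (S (M 0))
    have e3 : (θ + ‖b‖) * ‖S k‖ ≤ (θ + ‖b‖) * ρ := mul_le_mul_of_nonneg_left hk.1 (by positivity)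
    have e4 := hS.norm_le_of_timeAverage hε hT (M 0)
    have e5 : K * ‖timeAverage σ T (M 0)‖ ≤ K * δ' :=
      mul_le_mul_of_nonneg_left ((ContinuousMap.norm_le _ hδ').2 hM0) hK
    rw [← mul_assoc, hη] at e4
    have e6 : K * θ * ‖S k‖ ≤ K * θ * ρ := mul_le_mul_of_nonneg_left hk.1 (by positivity)
    have e7 : K * δ * ‖S k‖ ≤ K * δ * ρ := mul_le_mul_of_nonneg_left hk.1 (by positivity)
    have e8 : 2 * η * (K * ‖b‖) * ‖k‖ ≤ 2 * η * (K * ‖b‖) * m :=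
      mul_le_mul_of_nonneg_left hk.2 (by positivity)
    exact ⟨by linarith, by linarith⟩
  obtain ⟨k, hk, hfix⟩ := exists_fixedPoint_of_iterate hX ⟨0, h0X⟩ hmaps 2 (K := 1 / 2)
    (by norm_num) (by norm_num) fun k hk l hl => by
      simp only [Function.iterate_succ, Function.iterate_zero, Function.comp_def, id]
      rw [dist_eq_norm, dist_eq_norm]
      have e1 := hdiff _ _ (hmaps hk).1 (hmaps hl).1
      have e2 := hSdiff k l hk.1 hl.1
      have e3 := hS.norm_le (k - l)
      have e4 : K * θ * ‖S (k - l)‖ ≤ K * θ * (K * ‖k - l‖) :=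
        mul_le_mul_of_nonneg_left e3 (by positivity)
      have e5 : K * δ * ‖S (k - l)‖ ≤ K * δ * (K * ‖k - l‖) :=
        mul_le_mul_of_nonneg_left e3 (by positivity)
      have e6 : ‖S (Ψ k - Ψ l)‖ ≤
          (K * θ * K + K * δ * K + 2 * η * (K * ‖b‖)) * ‖k - l‖ := by linarith
      refine e1.trans ((mul_le_mul_of_nonneg_left e6 (by positivity)).trans ?_)
      rw [← mul_assoc]
      exact mul_le_mul_of_nonneg_right h₂ (norm_nonneg _)
  refine ⟨k, hk.1, fun ω => ?_⟩
  have := DFunLike.congr_fun hfix ω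
  rw [hΨ, sub_eq_iff_eq_add] at this
  exact this.symm

end IsGreenOperator

end GreenOperator

/-! ### The averaging theorem near a hyperbolic zero. -/

section Averaging

/-- A family continuous on `Ω × B` is equicontinuous at a point of `B`, for compact `Ω`. -/
theorem exists_radius_norm_sub_le {Ω E V : Type*} [TopologicalSpace Ω] [CompactSpace Ω]
    [NormedAddCommGroup E] [NormedAddCommGroup V] {x₀ : E} {r θ : ℝ}
    (hr : 0 < r) (hθ : 0 < θ) {φ : Ω → E → V}
    (hφ : ContinuousOn (Function.uncurry φ) (univ ×ˢ Metric.closedBall x₀ r)) :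
    ∃ ρ : ℝ, 0 < ρ ∧ ρ ≤ r ∧ ∀ ω, ∀ x ∈ Metric.closedBall x₀ ρ, ‖φ ω x - φ ω x₀‖ ≤ θ := by
  have hx₀ : x₀ ∈ Metric.closedBall x₀ r := Metric.mem_closedBall_self hr.le
  have hc₀ : Continuous fun ω => φ ω x₀ := by
    have := hφ.comp_continuous (f := fun ω : Ω => (ω, x₀)) (by fun_prop)
      fun ω => ⟨trivial, hx₀⟩
    exact this
  have key : ∀ᶠ x in 𝓝 x₀, ∀ ω ∈ (univ : Set Ω),
      x ∈ Metric.closedBall x₀ r → ‖φ ω x - φ ω x₀‖ < θ := by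
    refine isCompact_univ.eventually_forall_of_forall_eventually fun ω _ => ?_
    have h1 := hφ (ω, x₀) ⟨trivial, hx₀⟩
    have h2 : ContinuousWithinAt (fun p : Ω × E => ‖φ p.1 p.2 - φ p.1 x₀‖)
        (univ ×ˢ Metric.closedBall x₀ r) (ω, x₀) :=
      (h1.sub ((hc₀.comp continuous_fst).continuousAt.continuousWithinAt)).norm
    have h3 : ∀ᶠ p in 𝓝[univ ×ˢ Metric.closedBall x₀ r] (ω, x₀),
        ‖φ p.1 p.2 - φ p.1 x₀‖ < θ := h2.eventually_lt_const (by simpa using hθ)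
    rw [eventually_nhdsWithin_iff] at h3
    have h4 := (continuous_swap.tendsto (x₀, ω)).eventually h3
    filter_upwards [h4] with p hp hpB
    exact hp ⟨trivial, hpB⟩
  obtain ⟨d, hd, hball⟩ := Metric.eventually_nhds_iff.1 key
  refine ⟨min r (d / 2), lt_min hr (half_pos hd), min_le_left _ _, fun ω x hx => ?_⟩
  rw [Metric.mem_closedBall] at hx
  exact (hball (by linarith [min_le_right r (d / 2)]) ω trivial
    (hx.trans (min_le_left _ _))).le

variable {Ω E : Type*} [MetricSpace Ω] [NormedAddCommGroup E] [NormedSpace ℝ E]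

theorem eqOn_of_isSolution_of_lipschitzOnWith {σ : Flow ℝ Ω} {g : Ω → E → E} {D : Set E}
    {K : NNReal} (hg : ∀ ω, LipschitzOnWith K (g ω) D) (ω : Ω) (y z : ℝ → E)
    (hy : IsSolution σ g D ω y) (hz : IsSolution σ g D ω z) (h0 : y 0 = z 0) :
    EqOn y z (Ici 0) := by
  have hder : ∀ {x : ℝ → E}, IsSolution σ g D ω x → ∀ t, 0 ≤ t →
      HasDerivWithinAt x (g (σ t ω) (x t)) (Ici t) t := fun hx t ht =>
    (hx t ht).2.mono (Ici_subset_Ici.2 ht)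
  have hcont : ∀ {x : ℝ → E}, IsSolution σ g D ω x → ∀ T, ContinuousOn x (Icc 0 T) :=
    fun hx T t ht => (hx t ht.1).2.continuousWithinAt.mono Icc_subset_Ici_self
  intro T hT
  exact ODE_solution_unique_of_mem_Icc_right (v := fun t => g (σ t ω)) (s := fun _ => D)
    (fun t _ => hg _) (hcont hy T) (fun t ht => hder hy t ht.1) (fun t ht => (hy t ht.1).1)
    (hcont hz T) (fun t ht => hder hz t ht.1) (fun t ht => (hz t ht.1).1) h0 ⟨hT, le_rfl⟩

theorem mul_div_eight_le {c W x : ℝ} (hc : c ≤ W) (hW : 0 < W) (hx : 0 ≤ x) :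
    c * (x / (8 * W)) ≤ x / 8 := by
  rw [mul_div_assoc', div_le_div_iff₀ (by positivity) (by norm_num)]
  nlinarith [mul_le_mul_of_nonneg_right hc hx]

/-- The constants are chosen in the order `θ`, `ρ`, then, given `r₀`, the window `T`, and last `ε₁`.
Thus `ρ` is independent of `r₀`, and `ε T` can be made small after `T` is fixed. -/
theorem AveragingConditions.exists_isInvariantSection [CompactSpace Ω] [CompleteSpace E]
    {σ : Flow ℝ Ω} {x₀ : E}
    {r ε₀ : ℝ} {f : Ω → E → E} {f₁ : Ω → E → (E →L[ℝ] E)} {f₂ : Ω → E → (E →L[ℝ] E →L[ℝ] E)}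
    {fbar : E → E} {fbar₁ : E → (E →L[ℝ] E)} {fbar₂ : E → (E →L[ℝ] E →L[ℝ] E)}
    (hr : 0 < r) (hε₀ : 0 < ε₀) (h : AveragingConditions σ x₀ r f f₁ f₂ fbar fbar₁ fbar₂)
    (h0 : fbar x₀ = 0) (hspec : ∀ z ∈ complexSpectrum (fbar₁ x₀), z.re ≠ 0) :
    ∃ ρ : ℝ, 0 < ρ ∧ ρ ≤ r ∧ ∀ r₀ : ℝ, 0 < r₀ → r₀ ≤ ρ →
      ∃ ε₁ : ℝ, 0 < ε₁ ∧ ε₁ ≤ ε₀ ∧ ∀ ε : ℝ, 0 < ε → ε < ε₁ →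
        ∃ u : C(Ω, E), (∀ ω, u ω ∈ Metric.closedBall x₀ r₀) ∧
          IsInvariantSection σ (fun ω x => ε • f ω x) (Metric.closedBall x₀ r) u := by
  set A := fbar₁ x₀ with hA
  have hx₀ : x₀ ∈ Metric.closedBall x₀ r := Metric.mem_closedBall_self hr.le
  obtain ⟨K, hK, hgreen⟩ := exists_isGreenOperator (Ω := Ω) hspec
  have hcomp : ∀ w : C(Ω, E), ‖w‖ ≤ r → Continuous fun ω => f ω (x₀ + w ω) := fun w hw =>
    h.cont.comp_continuous (f := fun ω : Ω => (ω, x₀ + w ω)) (by fun_prop) fun ω =>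
      ⟨trivial, by
        rw [mem_closedBall_iff_norm, add_sub_cancel_left]
        exact (w.norm_coe_le_norm ω).trans hw⟩
  -- `f` is controlled only on the ball, hence the default value `0` for large `w`; it is never
  -- evaluated there.
  let M : C(Ω, E) → C(Ω, E) := fun w =>
    if hw : ‖w‖ ≤ r then ⟨fun ω => f ω (x₀ + w ω), hcomp w hw⟩ else 0
  have hM : ∀ w : C(Ω, E), ‖w‖ ≤ r → ∀ ω, M w ω = f ω (x₀ + w ω) := fun w hw ω => by
    simp only [M, dif_pos hw]
    rfl
  have hM0 : ∀ ω, M 0 ω = f ω x₀ := fun ω => by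
    rw [hM 0 (by simpa using hr.le)]
    simp
  have hf₁c : Continuous fun ω => f₁ ω x₀ :=
    h.cont₁.comp_continuous (f := fun ω : Ω => (ω, x₀)) (by fun_prop) fun ω => ⟨trivial, hx₀⟩
  -- The oscillating part of the linearization at `x₀`: it is not small, but its time averages tend
  -- to zero.
  let b : C(Ω, E →L[ℝ] E) := ⟨fun ω => f₁ ω x₀ - A, hf₁c.sub continuous_const⟩
  set β := ‖b‖ with hβ
  set W : ℝ := 1 + K + (1 + β) * K ^ 2 with hW
  have hβ0 : 0 ≤ β := norm_nonneg b
  have hW1 : 1 ≤ W := by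
    have : 0 ≤ (1 + β) * K ^ 2 := by positivity
    linarith
  have hW0 : 0 < W := by linarith
  have hKW : K ≤ W := by
    have : 0 ≤ (1 + β) * K ^ 2 := by positivity
    linarith
  have hK2W : (1 + β) * K ^ 2 ≤ W := by linarith
  set θ : ℝ := 1 / (8 * W) with hθ
  have hθ0 : 0 < θ := by positivity
  have hθ1 : θ ≤ 1 := by
    rw [hθ, div_le_one (by positivity)]
    linarith
  obtain ⟨ρ, hρ, hρr, hρθ⟩ := exists_radius_norm_sub_le hr hθ0 h.cont₁
  refine ⟨ρ, hρ, hρr, fun r₀ hr₀ hr₀ρ => ?_⟩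
  have hMlin : ∀ v w : C(Ω, E), ‖v‖ ≤ r₀ → ‖w‖ ≤ r₀ → ∀ ω,
      ‖M v ω - M w ω - (b ω + A) (v ω - w ω)‖ ≤ θ * ‖v - w‖ := by
    intro v w hv hw ω
    have hbA : b ω + A = f₁ ω x₀ := sub_add_cancel _ _
    have hmem : ∀ v : C(Ω, E), ‖v‖ ≤ r₀ → x₀ + v ω ∈ Metric.closedBall x₀ ρ := fun v hv => by
      rw [mem_closedBall_iff_norm, add_sub_cancel_left]
      exact ((v.norm_coe_le_norm ω).trans hv).trans hr₀ρ
    have h1 := Convex.norm_image_sub_le_of_norm_hasFDerivWithin_le' (φ := f₁ ω x₀)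
      (fun x hx => (h.deriv₁ ω x (Metric.closedBall_subset_closedBall hρr hx)).mono
        (Metric.closedBall_subset_closedBall hρr))
      (hρθ ω) (convex_closedBall x₀ ρ) (hmem w hw) (hmem v hv)
    rw [add_sub_add_left_eq_sub] at h1
    rw [hM v (hv.trans (hr₀ρ.trans hρr)), hM w (hw.trans (hr₀ρ.trans hρr)), hbA]
    exact h1.trans (mul_le_mul_of_nonneg_left ((v - w).norm_coe_le_norm ω) hθ0.le)
  set δ' : ℝ := r₀ / (8 * W) with hδ'
  have hδ'0 : 0 < δ' := by positivity
  obtain ⟨T, hT, hT₀, hT₁⟩ : ∃ T : ℝ, 0 < T ∧ (∀ ω, ‖timeAverage σ T (M 0) ω‖ ≤ δ') ∧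
      ∀ ω, ‖timeAverage σ T b ω‖ ≤ θ := by
    have e1 := Metric.tendstoUniformlyOn_iff.1 h.average δ' hδ'0
    have e2 := Metric.tendstoUniformlyOn_iff.1 h.average₁ θ hθ0
    obtain ⟨T, ⟨h1, h2⟩, hT⟩ := ((e1.and e2).and (eventually_gt_atTop 0)).exists
    refine ⟨T, hT, fun ω => ?_, fun ω => ?_⟩
    · have := (h1 (ω, x₀) ⟨trivial, hx₀⟩).le
      simp only [h0, dist_zero_left] at this
      simpa only [timeAverage_apply, hM0] using this
    · have := (h2 (ω, x₀) ⟨trivial, hx₀⟩).le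
      rw [dist_comm, dist_eq_norm] at this
      have e3 : timeAverage σ T b ω = T⁻¹ • (∫ t in (0 : ℝ)..T, f₁ (σ t ω) x₀) - A := by
        have hc : Continuous fun t => f₁ (σ t ω) x₀ :=
          continuous_comp_flow σ ⟨fun ω => f₁ ω x₀, hf₁c⟩ ω
        change T⁻¹ • (∫ t in (0 : ℝ)..T, (f₁ (σ t ω) x₀ - A)) = _
        rw [intervalIntegral.integral_sub (hc.intervalIntegrable _ _)
          (continuous_const.intervalIntegrable _ _), smul_sub, inv_smul_integral_const hT]
      rw [e3]
      exact this
  set m : ℝ := ‖M 0‖ + (1 + β) * r₀ with hm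
  have hm0 : 0 ≤ m := by positivity
  set V : ℝ := 1 + ‖M 0‖ + 2 * (K * β) * m + (1 + β) * (2 * (K * β)) with hV
  have hV0 : 0 < V := by positivity
  have hv1 : ‖M 0‖ ≤ V := by
    have : 0 ≤ 2 * (K * β) * m + (1 + β) * (2 * (K * β)) := by positivity
    linarith
  have hv2 : 2 * (K * β) * m ≤ V := by
    have : 0 ≤ ‖M 0‖ + (1 + β) * (2 * (K * β)) := by positivity
    linarith
  have hv3 : (1 + β) * (2 * (K * β)) ≤ V := by
    have : 0 ≤ ‖M 0‖ + 2 * (K * β) * m := by positivity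
    linarith
  -- The minimum serves both smallness conditions of the fixed point theorem, one measured against
  -- `r₀` and one against a constant. The five terms of the first are each at most `r₀ / 8`; the
  -- second totals at most `3 / 8`.
  set x : ℝ := min r₀ 1 with hx
  have hx0 : 0 < x := lt_min hr₀ one_pos
  set c : ℝ := T * (‖A‖ * K + 1) with hc
  have hc0 : 0 < c := by positivity
  refine ⟨min ε₀ (x / (8 * V) / c), lt_min hε₀ (by positivity), min_le_left _ _,
    fun ε hε hε₁ => ?_⟩
  obtain ⟨S, hS⟩ := hgreen σ ε hε
  set η : ℝ := ε * T * (‖A‖ * K + 1) with hη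
  have hη0 : 0 ≤ η := by positivity
  have hηx : η ≤ x / (8 * V) := by
    have := (hε₁.le.trans (min_le_right _ _))
    rwa [le_div_iff₀ hc0, hc, ← mul_assoc] at this
  have hηV : ∀ {q : ℝ}, 0 ≤ q → q ≤ V → η * q ≤ x / 8 := fun hq hqV => by
    rw [mul_comm]
    exact (mul_le_mul_of_nonneg_left hηx hq).trans (mul_div_eight_le hqV hV0 hx0.le)
  have hxr : x ≤ r₀ := min_le_left _ _
  have hx1 : x ≤ 1 := min_le_right _ _
  obtain ⟨k, hk, hkM⟩ := hS.exists_fixedPoint hε.le hK.le hT hr₀.le hθ0.le b hT₁ M hMlin hT₀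
    hδ'0.le hθ0.le (m := m) (add_le_add_right (mul_le_mul_of_nonneg_right
      (add_le_add_left hθ1 _) hr₀.le) _) rfl (by
      have e1 : K * δ' ≤ r₀ / 8 := mul_div_eight_le hKW hW0 hr₀.le
      have e2 := hηV (norm_nonneg (M 0)) hv1
      have e3 : K * θ ≤ 1 / 8 := mul_div_eight_le hKW hW0 zero_le_one
      have e4 := mul_le_mul_of_nonneg_right e3 hr₀.le
      have e5 := hηV (by positivity) hv2
      have e6 : 2 * η * (K * β) * m = η * (2 * (K * β) * m) := by ring
      rw [← hη, ← hβ, e6]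
      linarith) (by
      have e1 : (1 + β) * K ^ 2 * θ ≤ 1 / 8 := mul_div_eight_le hK2W hW0 zero_le_one
      have e2 := hηV (by positivity) hv3
      have e3 : (θ + β) * (K * θ * K + K * θ * K + 2 * η * (K * β)) ≤
          (1 + β) * (K * θ * K + K * θ * K + 2 * η * (K * β)) :=
        mul_le_mul_of_nonneg_right (add_le_add_left hθ1 _) (by positivity)
      have e4 : (1 + β) * (K * θ * K + K * θ * K + 2 * η * (K * β)) =
          2 * ((1 + β) * K ^ 2 * θ) + η * ((1 + β) * (2 * (K * β))) := by ring
      rw [← hη, ← hβ]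
      linarith)
  have hkr : ‖S k‖ ≤ r := hk.trans (hr₀ρ.trans hρr)
  refine ⟨ContinuousMap.const Ω x₀ + S k, fun ω => ?_, ?_⟩
  · rw [mem_closedBall_iff_norm]
    simpa using ((S k).norm_coe_le_norm ω).trans hk
  obtain ⟨M₁, hM₁⟩ := h.bdd₁
  refine isInvariantSection_of_hasDerivAt (fun ω => ?_) (fun ω t => ?_)
    (eqOn_of_isSolution_of_lipschitzOnWith (K := ‖ε‖₊ * M₁.toNNReal) fun ω => ?_)
  · rw [mem_closedBall_iff_norm]
    simpa using ((S k).norm_coe_le_norm ω).trans hkr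
  · have e1 := (hS.hasDerivAt k ω t).const_add x₀
    rw [add_comm (A _), hkM, hM _ hkr] at e1
    exact e1
  · have e1 : LipschitzOnWith M₁.toNNReal (f ω) (Metric.closedBall x₀ r) :=
      (convex_closedBall x₀ r).lipschitzOnWith_of_nnnorm_hasFDerivWithin_le (h.deriv₁ ω)
        fun x hx => by
          rw [← NNReal.coe_le_coe, coe_nnnorm]
          exact (hM₁ ω x hx).trans (Real.le_coe_toNNReal _)
    refine LipschitzOnWith.of_dist_le_mul fun y hy z hz => ?_
    rw [dist_smul₀, NNReal.coe_mul, coe_nnnorm, mul_assoc]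
    exact mul_le_mul_of_nonneg_left (e1.dist_le_mul y hy z hz) (norm_nonneg _)

end Averaging

/-! ### Assembly of the four statements. -/

theorem theorem6p2 {Ω : Type*} [MetricSpace Ω]
    {E : Type*} [NormedAddCommGroup E] [NormedSpace ℝ E] [CompleteSpace E]
    (σ : Flow ℝ Ω) (hσ : IsPseudoRecurrent σ) :
    -- every continuous invariant section has a pseudo recurrent image
    (∀ (g : Ω → E → E) (D : Set E) (u : C(Ω, E)),
      IsInvariantSection σ g D u → IsPseudoRecurrentManifold σ g D u) ∧
    -- the quasilinear equation `x' = A (ω t) x + f (ω t) + F (ω t, x)`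
    (∀ (A : C(Ω, E →L[ℝ] E)) (U : ℝ → Ω → (E →L[ℝ] E)) (P : C(Ω, E →L[ℝ] E)) (N ν : ℝ)
      (f : C(Ω, E)) (F : Ω → E → E) (L r : ℝ),
      IsCauchyOperator σ A U → IsHyperbolic σ U P N ν →
      Continuous (Function.uncurry F) →
      HasUniqueSolutions σ (fun ω x => A ω x + f ω + F ω x) →
      0 < L → L < ν / (2 * N) → 0 < r →
      (⨆ ω, ‖F ω (greenSection σ U P f ω)‖) * (ν / (2 * N) - L)⁻¹ ≤ r →
      (∀ ω, ∀ x₁ ∈ Metric.cthickening r (Set.range (greenSection σ U P f)),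
        ∀ x₂ ∈ Metric.cthickening r (Set.range (greenSection σ U P f)),
        ‖F ω x₁ - F ω x₂‖ ≤ L * ‖x₁ - x₂‖) →
      ∃ u : C(Ω, E),
        (∀ ω, u ω ∈ Metric.cthickening r (Set.range (greenSection σ U P f))) ∧
        IsPseudoRecurrentManifold σ (fun ω x => A ω x + f ω + F ω x) Set.univ u) ∧
    -- the perturbed equation `x' = A (ω t) x + f (ω t) + ε F (ω t, x)`
    (∀ (A : C(Ω, E →L[ℝ] E)) (U : ℝ → Ω → (E →L[ℝ] E)) (P : C(Ω, E →L[ℝ] E)) (N ν : ℝ)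
      (f : C(Ω, E)) (F : Ω → E → E) (L r ε₀ : ℝ),
      IsCauchyOperator σ A U → IsHyperbolic σ U P N ν →
      Continuous (Function.uncurry F) → 0 < ε₀ →
      (∀ ε ∈ Set.Icc (-ε₀) ε₀, HasUniqueSolutions σ (fun ω x => A ω x + f ω + ε • F ω x)) →
      0 < L → 0 < r →
      (∀ ω, ∀ x₁ ∈ Metric.cthickening r (Set.range (greenSection σ U P f)),
        ∀ x₂ ∈ Metric.cthickening r (Set.range (greenSection σ U P f)),
        ‖F ω x₁ - F ω x₂‖ ≤ L * ‖x₁ - x₂‖) →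
      ∃ ε₁ : ℝ, 0 < ε₁ ∧ ε₁ ≤ ε₀ ∧ ∀ ε : ℝ, |ε| < ε₁ →
        ∃ u : C(Ω, E),
          (∀ ω, u ω ∈ Metric.cthickening r (Set.range (greenSection σ U P f))) ∧
          IsPseudoRecurrentManifold σ (fun ω x => A ω x + f ω + ε • F ω x) Set.univ u) ∧
    -- the equation `x' = ε f (ω t, x)` near a hyperbolic zero `x₀` of the averaged field
    (∀ (x₀ : E) (r ε₀ : ℝ)
      (f : Ω → E → E) (f₁ : Ω → E → (E →L[ℝ] E)) (f₂ : Ω → E → (E →L[ℝ] E →L[ℝ] E))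
      (fbar : E → E) (fbar₁ : E → (E →L[ℝ] E)) (fbar₂ : E → (E →L[ℝ] E →L[ℝ] E)),
      0 < r → 0 < ε₀ →
      AveragingConditions σ x₀ r f f₁ f₂ fbar fbar₁ fbar₂ →
      fbar x₀ = 0 →
      (∀ z ∈ complexSpectrum (fbar₁ x₀), z.re ≠ 0) →
      ∃ ρ : ℝ, 0 < ρ ∧ ρ ≤ r ∧ ∀ r₀ : ℝ, 0 < r₀ → r₀ ≤ ρ →
        ∃ ε₁ : ℝ, 0 < ε₁ ∧ ε₁ ≤ ε₀ ∧ ∀ ε : ℝ, 0 < ε → ε < ε₁ →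
          ∃ u : C(Ω, E), (∀ ω, u ω ∈ Metric.closedBall x₀ r₀) ∧
            IsPseudoRecurrentManifold σ (fun ω x => ε • f ω x) (Metric.closedBall x₀ r) u) := by
  have : CompactSpace Ω := hσ.1
  have hbdd : ∀ {F : Ω → E → E} {γ : Ω → E}, Continuous (Function.uncurry F) → Continuous γ →
      BddAbove (range fun ω => ‖F ω (γ ω)‖) := fun {F γ} hF hγ =>
    (isCompact_range (hF.comp (by fun_prop : Continuous fun ω => (ω, γ ω))).norm).bddAbove
  refine ⟨fun g D u hu => hu.isPseudoRecurrentManifold hσ, ?_, ?_, ?_⟩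
  · intro A U P N ν f F L r hU hH hF hsol hL₀ hL hr hγ hLip
    obtain ⟨u, hu, hinv⟩ := hH.exists_isInvariantSection hU f hF hsol hL₀.le hL hr.le (fun ω => by
      refine (le_ciSup (hbdd hF (hH.continuous_greenSection hU f)) ω).trans ?_
      rwa [← div_eq_mul_inv, div_le_iff₀ (sub_pos.2 hL), mul_comm] at hγ) hLip
    exact ⟨u, hu, hinv.isPseudoRecurrentManifold hσ⟩
  · intro A U P N ν f F L r ε₀ hU hH hF hε₀ hsol hL₀ hr hLip
    have hN := hH.N_pos
    have hν := hH.nu_pos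
    have hb := hbdd hF (hH.continuous_greenSection hU f)
    set κ : ℝ := ν / (2 * N) with hκ
    have hκ0 : 0 < κ := by positivity
    set γ₀ : ℝ := ⨆ ω, ‖F ω (greenSection σ U P f ω)‖ with hγ₀
    have hγ₀0 : 0 ≤ γ₀ := Real.iSup_nonneg fun _ => norm_nonneg _
    have hden : 0 < γ₀ + L * r + L := by positivity
    -- The bound gives `|ε| (γ₀ + L r + L) < κ min r 1`, which contains both `|ε| L < κ` and `|ε| γ₀
    -- ≤ (κ - |ε| L) r`, the two conditions needed for `ε F`.
    refine ⟨min ε₀ (κ * min r 1 / (γ₀ + L * r + L)),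
      lt_min hε₀ (by have := lt_min hr one_pos; positivity), min_le_left _ _, fun ε hε => ?_⟩
    have h1 := hε.trans_le (min_le_right _ _)
    rw [lt_div_iff₀ hden] at h1
    have h2 : κ * min r 1 ≤ κ * r := mul_le_mul_of_nonneg_left (min_le_left _ _) hκ0.le
    have h3 : κ * min r 1 ≤ κ * 1 := mul_le_mul_of_nonneg_left (min_le_right _ _) hκ0.le
    have h4 : 0 ≤ |ε| * γ₀ := by positivity
    have h5 : 0 ≤ |ε| * (L * r) := by positivity
    have h6 : 0 ≤ |ε| * L := by positivity
    obtain ⟨u, hu, hinv⟩ := hH.exists_isInvariantSection hU f (F := fun ω x => ε • F ω x)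
      (L := |ε| * L) (r := r) (hF.const_smul ε)
      (hsol ε (abs_le.1 (hε.le.trans (min_le_left _ _)))) h6 (by linarith) hr.le (fun ω => by
        have h7 := mul_le_mul_of_nonneg_left (le_ciSup hb ω) (abs_nonneg ε)
        rw [norm_smul, Real.norm_eq_abs]
        linarith) (fun ω x₁ hx₁ x₂ hx₂ => by
        rw [← smul_sub, norm_smul, Real.norm_eq_abs, mul_assoc]
        exact mul_le_mul_of_nonneg_left (hLip ω x₁ hx₁ x₂ hx₂) (abs_nonneg ε))
    exact ⟨u, hu, hinv.isPseudoRecurrentManifold hσ⟩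
  · intro x₀ r ε₀ f f₁ f₂ fbar fbar₁ fbar₂ hr hε₀ h h0 hspec
    obtain ⟨ρ, hρ, hρr, H⟩ := h.exists_isInvariantSection hr hε₀ h0 hspec
    refine ⟨ρ, hρ, hρr, fun r₀ hr₀ hr₀ρ => ?_⟩
    obtain ⟨ε₁, hε₁, hle, H⟩ := H r₀ hr₀ hr₀ρ
    refine ⟨ε₁, hε₁, hle, fun ε hε hlt => ?_⟩
    obtain ⟨u, hu, hinv⟩ := H ε hε hlt
    exact ⟨u, hu, hinv.isPseudoRecurrentManifold hσ⟩
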